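/- **Setting.** Let $\mathcal M=(S,A_1\times\dots\times A_n,P,H,s_0)$ be an $n$-agent Markov game with finite state set $S$, finite action sets $A_i$ (put $\mathcal A=\prod_i A_i$), transition probabilities $P(s'\mid s,a)$, horizon $H\in\mathbb N$ and initial state $s_0$. Let $\mathcal Z=(S\times\mathcal A)^*\times S$ be the set of finite trajectories. A policy of agent $i$ is a map $\pi_i:\mathcal Z\to\mathcal D(A_i)$ into the distributions on $A_i$; under $(\pi_1,\dots,\pi_n)$ the agents draw their actions independently, and $\mathcal D_\pi$ is the induced law of trajectories of length $H$. Agent $i$ has a specification $\phi_i$ generated by $\phi::=\mathtt{achieve}\ b\mid\phi\ \mathtt{ensuring}\ b\mid\phi_1;\phi_2\mid\phi_1\ \mathtt{or}\ \phi_2$, where $b$ is a positive Boolean combination of atomic state predicates. For $\zeta$ with states $s_0,\dots,s_t$: $\zeta\models\mathtt{achieve}\ b$ iff some $s_i\models b$; $\zeta\models\phi\ \mathtt{ensuring}\ b$ iff $\zeta\models\phi$ and all $s_i\models b$; $\zeta\models\phi_1;\phi_2$ iff $\zeta_{0:i}\models\phi_1$ and $\zeta_{i+1:t}\models\phi_2$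 for some $i<t$; $\mathtt{or}$ is disjunction. The score is $J_i(\pi)=\Pr_{\zeta\sim\mathcal D_\pi}[\zeta\models\phi_i]$, and $\pi$ is an $\varepsilon$-Nash equilibrium if $J_i(\pi)\ge J_i(\pi_{-i},\pi_i')-\varepsilon$ for all $i$ and all policies $\pi_i'$ of agent $i$. **The algorithm HighNashSearch** (inputs $\mathcal M,\phi_1,\dots,\phi_n,\varepsilon,\delta,p$). 1. An arbitrary (possibly randomized) enumeration procedure produces a finite list of finite-state deterministic joint policies $\pi=(M,\alpha,\sigma,m_0)$, with memory update $\alpha:S\times\mathcal A\times M\to M$, action choice $\sigma:S\times M\to\mathcal A$ and initial memory state $m_0$. 2. From each $\phi_j$ build a reward machine $\mathcal R_j$ with finite state set $Q_j$, transitions $\delta_u^j$ and rewards $\delta_r^j(s,q)$: run a deterministic automaton accepting exactly the state sequences of the trajectories that satisfy $\phi_j$, and pay $+1$ on entering and $-1$ on leaving the set of accepting states. Let $|Q|=\max_j|Q_j|$ and let $|M|$ be the largest memory size in the list. 3. BFS-Estimate: explore the states in breadth-first order from $s_0$. For each discovered state $s$ and each $a\in\mathcal A$ draw $$K=\Big\lceil\tfrac{2|S|^2|M|^2|Q|^2H^4}{\delta^2}\log\tfrac{2|S|^2|\mathcal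 A|}{p}\Big\rceil$$ fresh independent samples from $P(\cdot\mid s,a)$, add the new states to the queue, and let $\tilde P(\cdot\mid s,a)$ be the empirical frequencies. 4. For a candidate $\pi$ and an agent $j$, the punishment game $\tilde{\mathcal M}_j^\pi$ over $\tilde P$ has the states $(s,m,q,b)\in S\times M\times Q_j\times\{\bot,\top\}$ and initial state $(s_0,m_0,q_0^j,\bot)$; $b$ records whether $j$ has deviated from $\pi$. The max-player is agent $j$ and the min-player is the coalition of the agents $i\ne j$. A policy $\bar\pi_2$ of the coalition is a tuple $(\bar\pi_{2,i})_{i\ne j}$ of individual policies of its members, which randomize independently. While $b=\bot$, the actions of the coalition are ignored and replaced by those of $\pi$, and trajectories record the executed actions. Let $\bar J(\bar\pi_1,\bar\pi_2)$ be the expected sum of the rewards $\delta_r^j(s_k,q_k)$, $0\le k\le H$. Put $\widetilde{\mathrm{dev}}_j=\min_{\bar\pi_2}\max_{\bar\pi_1}\bar J(\bar\pi_1,\bar\pi_2)$, let $\bar\pi_2^*$ be any minimizer, and let $\tau_{ij}(\zeta)$ be $\bar\pi^*_{2,i}$ evaluated at $\zeta$ annotated with its memory states, reward machine states and deviation flags.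 5. Return $\pi\bowtie\tau$ for the first candidate $\pi$ in the list with $\widetilde{\mathrm{dev}}_j\le J_j(\pi)+\varepsilon-\delta$ for all $j$; return nothing if there is none. Here, in $\pi\bowtie\tau$, agent $i$ follows $\pi$ as long as nobody has deviated from $\pi$, and plays $\tau_{ij}$ once agent $j\ne i$ is the first deviator (the smallest index in case of a tie; an agent that is itself the first deviator returns to $\pi$). **Corollary (Soundness).** For all $p\in(0,1]$, $\varepsilon>0$ and $\delta\in(0,\varepsilon)$, the following holds with probability at least $1-p$: if HighNashSearch returns a joint policy $\pi\bowtie\tau$, then $\pi\bowtie\tau$ is an $\varepsilon$-Nash equilibrium of $\mathcal M$ with respect to the scores $J_1,\dots,J_n$. -/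

import Mathlib

/-! ## Trajectories, policies and Markov games -/

namespace SpecNash

/-- The set `(S × A)* × S` of finite trajectories `s₀ a₀ s₁ a₁ … s_t`: the list of the pairs
`(s_k, a_k)`, `k < t`, in chronological order, together with the last state `s_t`. -/
structure Traj (S A : Type*) where
  hist : List (S × A)
  last : S

/-- The states `s₀, …, s_t` of a trajectory. -/
def Traj.states {S A : Type*} (ζ : Traj S A) : List S := ζ.hist.map Prod.fst ++ [ζ.last]

/-- The trajectory `ζ` followed by the action `a` and the state `s`. -/
def Traj.snoc {S A : Type*} (ζ : Traj S A) (a : A) (s : S) : Traj S A :=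
  ⟨ζ.hist ++ [(ζ.last, a)], s⟩

/-- An `n`-agent Markov game with states `S`, actions `A i` of agent `i`, transition probabilities
`P`, horizon `H` and initial state `s₀`. (Finiteness of `S` and of the `A i` is imposed by
instance arguments.) -/
structure MarkovGame (n : ℕ) (S : Type*) (A : Fin n → Type*) where
  P : S → (∀ i, A i) → PMF S
  H : ℕ
  s₀ : S

/-- A policy choosing actions in `B`, in a game with states `S` and joint actions `A`. -/
abbrev Policy (S A B : Type*) := Traj S A → PMF B

/-- A tuple `(π₁, …, πₙ)` of individual policies. -/
abbrev Profile {n : ℕ} (S : Type*) (A : Fin n → Type*) := ∀ i, Policy S (∀ i, A i) (A i)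

/-- The law of a family of independent random variables with laws `μ i`. -/
noncomputable def prodPMF {ι : Type*} [Fintype ι] [DecidableEq ι] {B : ι → Type*}
    [∀ i, Fintype (B i)] (μ : ∀ i, PMF (B i)) : PMF (∀ i, B i) :=
  PMF.ofFintype (fun a => ∏ i, μ i (a i)) (by
    rw [← Fintype.prod_sum]
    refine Finset.prod_eq_one fun i _ => ?_
    rw [← tsum_fintype (L := .unconditional _)]
    exact (μ i).tsum_coe)

/-- The distribution over trajectories of length `t` from the initial state: at each step the
agents draw their actions independently, each from its own policy. -/
noncomputable def trajLaw {n : ℕ} {S : Type*} {A : Fin n → Type*} [∀ i, Fintype (A i)]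
    (G : MarkovGame n S A) (π : Profile S A) : ℕ → PMF (Traj S (∀ i, A i))
  | 0 => PMF.pure ⟨[], G.s₀⟩
  | t + 1 => (trajLaw G π t).bind fun ζ =>
      (prodPMF fun i => π i ζ).bind fun a =>
        (G.P ζ.last a).map fun s => ζ.snoc a s

/-! ## Specifications -/

/-- Predicates: positive Boolean combinations of atomic predicates. -/
inductive Pred (AP : Type*) where
  | atom (p : AP) : Pred AP
  | and (b₁ b₂ : Pred AP) : Pred AP
  | or (b₁ b₂ : Pred AP) : Pred AP

/-- The interpretation of a predicate, given that of the atomic predicates. -/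
def Pred.eval {AP S : Type*} (I : AP → S → Bool) : Pred AP → S → Bool
  | .atom p, s => I p s
  | .and b₁ b₂, s => b₁.eval I s && b₂.eval I s
  | .or b₁ b₂, s => b₁.eval I s || b₂.eval I s

/-- Specifications: `achieve b`, `φ ensuring b`, `φ₁; φ₂`, `φ₁ or φ₂`. -/
inductive Spec (AP : Type*) where
  | achieve (b : Pred AP) : Spec AP
  | ensuring (φ : Spec AP) (b : Pred AP) : Spec AP
  | seq (φ₁ φ₂ : Spec AP) : Spec AP
  | choice (φ₁ φ₂ : Spec AP) : Spec AP

/-- Satisfaction of a specification by a trajectory with states `w = s₀ … s_t`; it does not depend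
on the actions. For `i < t`, the subtrajectories `ζ_{0:i}` and `ζ_{i+1:t}` have the states
`w.take (i + 1)` and `w.drop (i + 1)`. -/
def Spec.Sat {AP S : Type*} (I : AP → S → Bool) : Spec AP → List S → Prop
  | .achieve b, w => ∃ s ∈ w, b.eval I s = true
  | .ensuring φ b, w => φ.Sat I w ∧ ∀ s ∈ w, b.eval I s = true
  | .seq φ₁ φ₂, w => ∃ i, i + 1 < w.length ∧ φ₁.Sat I (w.take (i + 1)) ∧ φ₂.Sat I (w.drop (i + 1))
  | .choice φ₁ φ₂, w => φ₁.Sat I w ∨ φ₂.Sat I w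

/-- The score of an agent with specification `φ`: the probability that a trajectory of length `H`
generated by `π` satisfies `φ`. -/
noncomputable def score {n : ℕ} {S AP : Type*} {A : Fin n → Type*} [∀ i, Fintype (A i)]
    (G : MarkovGame n S A) (I : AP → S → Bool) (φ : Spec AP) (π : Profile S A) : ℝ :=
  ((trajLaw G π G.H).toOuterMeasure {ζ | φ.Sat I ζ.states}).toReal

/-- `π` is an `ε`-Nash equilibrium: no agent `i` can increase its score by more than `ε` by
replacing its own policy. -/
def IsEpsNash {n : ℕ} {S AP : Type*} {A : Fin n → Type*} [∀ i, Fintype (A i)]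
    (G : MarkovGame n S A) (I : AP → S → Bool) (φ : Fin n → Spec AP) (ε : ℝ)
    (π : Profile S A) : Prop :=
  ∀ (i : Fin n) (π' : Policy S (∀ i, A i) (A i)),
    score G I (φ i) π ≥ score G I (φ i) (Function.update π i π') - ε

/-! ## Finite-state deterministic joint policies and punishment strategies -/

/-- A finite-state deterministic joint policy `(M, α, σ, m₀)`; the finite set `M` of memory states
is numbered, `M = {0, …, mem - 1}`. -/
structure FSPolicy {n : ℕ} (S : Type*) (A : Fin n → Type*) where
  mem : ℕ
  α : S → (∀ i, A i) → Fin mem → Fin mem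
  σ : S → Fin mem → ∀ i, A i
  m₀ : Fin mem

/-- The extended memory update function. -/
def FSPolicy.memory {n : ℕ} {S : Type*} {A : Fin n → Type*} (π : FSPolicy S A)
    (h : List (S × (∀ i, A i))) : Fin π.mem :=
  h.foldl (fun m sa => π.α sa.1 sa.2 m) π.m₀

/-- The joint action chosen after the trajectory `ζ`. -/
def FSPolicy.act {n : ℕ} {S : Type*} {A : Fin n → Type*} (π : FSPolicy S A)
    (ζ : Traj S (∀ i, A i)) : ∀ i, A i :=
  π.σ ζ.last (π.memory ζ.hist)

/-- The individual policies of the agents under `π`. -/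
noncomputable def FSPolicy.toProfile {n : ℕ} {S : Type*} {A : Fin n → Type*} (π : FSPolicy S A) :
    Profile S A :=
  fun i ζ => PMF.pure (π.act ζ i)

open Classical in
/-- The agent that deviated the earliest from `π` along the history `h`, started with memory `m`
(the smallest such agent, if several deviate at the same step); `none` if nobody deviated. -/
noncomputable def FSPolicy.firstDeviatorFrom {n : ℕ} {S : Type*} {A : Fin n → Type*}
    (π : FSPolicy S A) : Fin π.mem → List (S × (∀ i, A i)) → Option (Fin n)
  | _, [] => none
  | m, (s, a) :: h =>
      match (List.finRange n).find? (fun j => decide (a j ≠ π.σ s m j)) with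
      | some j => some j
      | none => π.firstDeviatorFrom (π.α s a m) h

/-- Punishment strategies: `τ j i` is the strategy of agent `i ≠ j` against agent `j`; so `τ j` is
the set of punishment strategies against `j`. -/
abbrev Punishment {n : ℕ} (S : Type*) (A : Fin n → Type*) :=
  ∀ j : Fin n, ∀ i : {i : Fin n // i ≠ j}, Policy S (∀ i, A i) (A i)

/-- The profile `π ⋈ τ`: agent `i` follows `π` as long as nobody has deviated, and punishes the
first deviator `j` with `τ j i` afterwards. (If `i` itself is the first deviator, no punishment
strategy applies; then `i` returns to `π`.) -/
noncomputable def FSPolicy.join {n : ℕ} {S : Type*} {A : Fin n → Type*} (π : FSPolicy S A)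
    (τ : Punishment S A) : Profile S A :=
  fun i ζ =>
    match π.firstDeviatorFrom π.m₀ ζ.hist with
    | none => PMF.pure (π.act ζ i)
    | some j => if h : i ≠ j then τ j ⟨i, h⟩ ζ else PMF.pure (π.act ζ i)

/-! ## Reward machines -/

/-- A reward machine with state set `Q`. -/
structure RewardMachine (S A Q : Type*) where
  δu : S → A → Q → Q
  δr : S → Q → ℝ
  q₀ : Q

/-- The state set of the automaton of a specification. -/
def Spec.Q {AP : Type*} : Spec AP → Type
  | .achieve _ => Bool
  | .ensuring φ _ => Option φ.Q
  | .seq φ₁ φ₂ => Set (φ₁.Q ⊕ φ₂.Q)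
  | .choice φ₁ φ₂ => Set (φ₁.Q ⊕ φ₂.Q)

theorem Spec.finite_Q {AP : Type*} (φ : Spec AP) : Finite φ.Q := by
  induction φ with
  | achieve b => exact inferInstanceAs (Finite Bool)
  | ensuring φ b ih => exact inferInstanceAs (Finite (Option φ.Q))
  | seq φ₁ φ₂ ih₁ ih₂ => exact inferInstanceAs (Finite (Set (φ₁.Q ⊕ φ₂.Q)))
  | choice φ₁ φ₂ ih₁ ih₂ => exact inferInstanceAs (Finite (Set (φ₁.Q ⊕ φ₂.Q)))

noncomputable instance {AP : Type*} (φ : Spec AP) : Fintype φ.Q :=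
  @Fintype.ofFinite _ φ.finite_Q

/-- Automaton of `achieve b`. -/
def achieveDFA {S : Type*} (b : S → Bool) : DFA S Bool where
  step q s := q || b s
  start := false
  accept := {true}

/-- Automaton of `φ ensuring b`: the transitions on letters violating `b` lead to the dead state
`none`. -/
def ensuringDFA {S Q : Type*} (D : DFA S Q) (b : S → Bool) : DFA S (Option Q) where
  step q s := q.bind fun q => if b s then some (D.step q s) else none
  start := some D.start
  accept := some '' D.accept

/-- Nondeterministic automaton of `φ₁; φ₂`: a transition entering an accepting state of the first
automaton may be diverted to the initial state of the second. -/
def seqNFA {S Q₁ Q₂ : Type*} (D₁ : DFA S Q₁) (D₂ : DFA S Q₂) : NFA S (Q₁ ⊕ Q₂) where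
  step q s := match q with
    | .inl q => {x | x = .inl (D₁.step q s) ∨ (D₁.step q s ∈ D₁.accept ∧ x = .inr D₂.start)}
    | .inr q => {.inr (D₂.step q s)}
  start := {.inl D₁.start}
  accept := Sum.inr '' D₂.accept

/-- Nondeterministic automaton of `φ₁ or φ₂`: the disjoint union. -/
def choiceNFA {S Q₁ Q₂ : Type*} (D₁ : DFA S Q₁) (D₂ : DFA S Q₂) : NFA S (Q₁ ⊕ Q₂) where
  step q s := match q with
    | .inl q => {.inl (D₁.step q s)}
    | .inr q => {.inr (D₂.step q s)}
  start := {.inl D₁.start, .inr D₂.start}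
  accept := Sum.inl '' D₁.accept ∪ Sum.inr '' D₂.accept

/-- The complete deterministic automaton of a specification, reading the states of a trajectory. -/
def Spec.dfa {AP S : Type*} (I : AP → S → Bool) : (φ : Spec AP) → DFA S φ.Q
  | .achieve b => achieveDFA (b.eval I)
  | .ensuring φ b => ensuringDFA (φ.dfa I) (b.eval I)
  | .seq φ₁ φ₂ => (seqNFA (φ₁.dfa I) (φ₂.dfa I)).toDFA
  | .choice φ₁ φ₂ => (choiceNFA (φ₁.dfa I) (φ₂.dfa I)).toDFA

open Classical in
/-- `ConstructRM`: the reward machine of a specification. It pays `1` when its automaton enters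
the set of accepting states and `-1` when it leaves it. -/
noncomputable def Spec.rm {AP S : Type*} (I : AP → S → Bool) (A : Type*) (φ : Spec AP) :
    RewardMachine S A φ.Q where
  δu s _ q := (φ.dfa I).step q s
  δr s q :=
    if q ∉ (φ.dfa I).accept ∧ (φ.dfa I).step q s ∈ (φ.dfa I).accept then 1
    else if q ∈ (φ.dfa I).accept ∧ (φ.dfa I).step q s ∉ (φ.dfa I).accept then -1
    else 0
  q₀ := (φ.dfa I).start

/-! ## The punishment game of an agent -/

/-- The states `(s, m, q, b)` of the punishment game; `b = true` means that the agent has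
deviated. -/
abbrev PState (S M Q : Type*) := S × M × Q × Bool

open Classical in
/-- The deviation update function of agent `j`. -/
noncomputable def devUpdate {n : ℕ} {S : Type*} {A : Fin n → Type*} (π : FSPolicy S A) (j : Fin n)
    (s : S) (a : ∀ i, A i) (m : Fin π.mem) (b : Bool) : Bool :=
  b || decide (a j ≠ π.σ s m j)

/-- The joint action executed in a state of the punishment game of agent `j` when the joint action
`a` is chosen: until `j` deviates, the actions of the other agents are ignored and replaced by
those of `π`. -/
def execAction {n : ℕ} {S Q : Type*} {A : Fin n → Type*} (π : FSPolicy S A) (j : Fin n)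
    (x : PState S (Fin π.mem) Q) (a : ∀ i, A i) : ∀ i, A i :=
  match x with
  | (s, m, _, b) => if b = true then a else Function.update (π.σ s m) j (a j)

open Classical in
/-- `ConstructGame`: the transition function of the punishment game of agent `j` with respect to
`π` and the reward machine `R`, built over the transition function `P` of a model. -/
noncomputable def gameP {n : ℕ} {S Q : Type*} {A : Fin n → Type*}
    (P : S → (∀ i, A i) → S → ℝ) (π : FSPolicy S A) (j : Fin n)
    (R : RewardMachine S (∀ i, A i) Q) (x : PState S (Fin π.mem) Q) (a : ∀ i, A i)
    (x' : PState S (Fin π.mem) Q) : ℝ :=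
  match x, x' with
  | (s, m, q, b), (s', m', q', b') =>
      let a' := execAction π j (s, m, q, b) a
      if m' = π.α s a' m ∧ q' = R.δu s a' q ∧ b' = devUpdate π j s a m b then P s a' s' else 0

/-- Trajectories of the punishment game; the recorded joint actions are the executed ones. -/
abbrev PTraj {n : ℕ} {S : Type*} {A : Fin n → Type*} (π : FSPolicy S A) (Q : Type*) :=
  Traj (PState S (Fin π.mem) Q) (∀ i, A i)

/-- Policies of the max-agent, i.e. of agent `j`. -/
abbrev MaxPolicy {n : ℕ} {S : Type*} {A : Fin n → Type*} (π : FSPolicy S A) (Q : Type*)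
    (j : Fin n) := PTraj π Q → PMF (A j)

/-- Policies of the min-agent, i.e. of the coalition of the agents `i ≠ j`: each member chooses its
action in accordance with its own policy, as in every joint policy of the form `(π₁, …, πₙ)`. -/
abbrev MinPolicy {n : ℕ} {S : Type*} {A : Fin n → Type*} (π : FSPolicy S A) (Q : Type*)
    (j : Fin n) := ∀ i : {i : Fin n // i ≠ j}, PTraj π Q → PMF (A i)

/-- The expectation of `F` over the trajectories obtained from `ζ` after `t` further steps of the
punishment game, when the policies `π₁` and `π₂` are used. -/
noncomputable def gameExp {n : ℕ} {S Q : Type*} {A : Fin n → Type*} [Fintype S] [Fintype Q]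
    [∀ i, Fintype (A i)] (P : S → (∀ i, A i) → S → ℝ) (π : FSPolicy S A) (j : Fin n)
    (R : RewardMachine S (∀ i, A i) Q) (π₁ : MaxPolicy π Q j) (π₂ : MinPolicy π Q j)
    (F : PTraj π Q → ℝ) : ℕ → PTraj π Q → ℝ
  | 0, ζ => F ζ
  | t + 1, ζ => ∑ a : ∀ i, A i,
      (π₁ ζ (a j)).toReal * (∏ i : {i : Fin n // i ≠ j}, (π₂ i ζ (a i)).toReal) *
        ∑ x' : PState S (Fin π.mem) Q, gameP P π j R ζ.last a x' *
          gameExp P π j R π₁ π₂ F t (ζ.snoc (execAction π j ζ.last a) x')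

/-- The expected sum of the rewards `δr s_k q_k`, `0 ≤ k ≤ H`, over the trajectories of length
`H + 1` of the punishment game. -/
noncomputable def gameValue {n : ℕ} {S Q : Type*} {A : Fin n → Type*} [Fintype S] [Fintype Q]
    [∀ i, Fintype (A i)] (H : ℕ) (s₀ : S) (P : S → (∀ i, A i) → S → ℝ) (π : FSPolicy S A)
    (j : Fin n) (R : RewardMachine S (∀ i, A i) Q) (π₁ : MaxPolicy π Q j)
    (π₂ : MinPolicy π Q j) : ℝ :=
  gameExp P π j R π₁ π₂ (fun ζ => (ζ.hist.map fun xa => R.δr xa.1.1 xa.1.2.2.1).sum) (H + 1)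
    ⟨[], (s₀, π.m₀, R.q₀, false)⟩

/-- The min-max value of the punishment game. -/
noncomputable def minMaxValue {n : ℕ} {S Q : Type*} {A : Fin n → Type*} [Fintype S] [Fintype Q]
    [∀ i, Fintype (A i)] (H : ℕ) (s₀ : S) (P : S → (∀ i, A i) → S → ℝ) (π : FSPolicy S A)
    (j : Fin n) (R : RewardMachine S (∀ i, A i) Q) : ℝ :=
  ⨅ π₂ : MinPolicy π Q j, ⨆ π₁ : MaxPolicy π Q j, gameValue H s₀ P π j R π₁ π₂

/-- `π₂` is a minimizer in the definition of the min-max value. -/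
def IsArgMin {n : ℕ} {S Q : Type*} {A : Fin n → Type*} [Fintype S] [Fintype Q]
    [∀ i, Fintype (A i)] (H : ℕ) (s₀ : S) (P : S → (∀ i, A i) → S → ℝ) (π : FSPolicy S A)
    (j : Fin n) (R : RewardMachine S (∀ i, A i) Q) (π₂ : MinPolicy π Q j) : Prop :=
  ∀ π₂' : MinPolicy π Q j,
    (⨆ π₁ : MaxPolicy π Q j, gameValue H s₀ P π j R π₁ π₂) ≤
      ⨆ π₁ : MaxPolicy π Q j, gameValue H s₀ P π j R π₁ π₂'

/-- A trajectory with history `h` and last state `t`, annotated with the memory states, the reward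
machine states and the deviation flags, starting from `m`, `q` and `b`. -/
noncomputable def annotate {n : ℕ} {S Q : Type*} {A : Fin n → Type*} (π : FSPolicy S A)
    (j : Fin n) (R : RewardMachine S (∀ i, A i) Q) :
    Fin π.mem → Q → Bool → List (S × (∀ i, A i)) → S → PTraj π Q
  | m, q, b, [], t => ⟨[], (t, m, q, b)⟩
  | m, q, b, (s, a) :: h, t =>
      let ζ := annotate π j R (π.α s a m) (R.δu s a q) (devUpdate π j s a m b) h t
      ⟨((s, m, q, b), a) :: ζ.hist, ζ.last⟩

/-- `PunStrat`: the punishment strategies against `j` that correspond to a policy of the coalition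
in the punishment game. -/
noncomputable def punStrat {n : ℕ} {S Q : Type*} {A : Fin n → Type*} (π : FSPolicy S A)
    (j : Fin n) (R : RewardMachine S (∀ i, A i) Q) (π₂ : MinPolicy π Q j) :
    ∀ i : {i : Fin n // i ≠ j}, Policy S (∀ i, A i) (A i) :=
  fun i ζ => π₂ i (annotate π j R π.m₀ R.q₀ false ζ.hist ζ.last)

/-! ## Estimation of the model -/

/-- The data of the breadth-first search: discovered states, queue, and estimated transition
probabilities (`0` where nothing has been stored). -/
structure BFSState {n : ℕ} (S : Type*) (A : Fin n → Type*) where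
  seen : Finset S
  queue : List S
  est : S → (∀ i, A i) → S → ℝ

open Classical in
/-- Add the state `s` to the discovered states and to the queue if it is new. -/
noncomputable def BFSState.discover {n : ℕ} {S : Type*} {A : Fin n → Type*} (d : BFSState S A)
    (s : S) : BFSState S A :=
  if s ∈ d.seen then d else { d with seen := insert s d.seen, queue := d.queue ++ [s] }

open Classical in
/-- Store the relative frequencies in the sample `X` as the estimate of `P(· ∣ s, a)`. -/
noncomputable def BFSState.store {n : ℕ} {S : Type*} {A : Fin n → Type*} (d : BFSState S A)
    (s : S) (a : ∀ i, A i) {K : ℕ} (X : Fin K → S) : BFSState S A :=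
  { d with est := fun s₁ a₁ s' =>
      if s₁ = s ∧ a₁ = a then ((Finset.univ.filter fun x => X x = s').card : ℝ) / (K : ℝ)
      else d.est s₁ a₁ s' }

/-- Draw `K` independent samples from `P(· ∣ s, a)`, record the new states, store the estimate. -/
noncomputable def exploreAction {n : ℕ} {S : Type*} {A : Fin n → Type*} [Fintype S]
    (G : MarkovGame n S A) (K : ℕ) (s : S) (a : ∀ i, A i) (d : BFSState S A) :
    PMF (BFSState S A) :=
  (prodPMF fun _ : Fin K => G.P s a).map fun X =>
    ((List.ofFn X).foldl BFSState.discover d).store s a X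

/-- Explore the actions of a list one after the other in the state `s`. -/
noncomputable def exploreActions {n : ℕ} {S : Type*} {A : Fin n → Type*} [Fintype S]
    (G : MarkovGame n S A) (K : ℕ) (s : S) :
    List (∀ i, A i) → BFSState S A → PMF (BFSState S A)
  | [], d => PMF.pure d
  | a :: l, d => (exploreAction G K s a d).bind (exploreActions G K s l)

/-- The main loop, run until the queue is empty, for at most the given number of rounds. -/
noncomputable def bfsLoop {n : ℕ} {S : Type*} {A : Fin n → Type*} [Fintype S]
    [∀ i, Fintype (A i)] (G : MarkovGame n S A) (K : ℕ) : ℕ → BFSState S A → PMF (BFSState S A)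
  | 0, d => PMF.pure d
  | r + 1, d =>
      match d.queue with
      | [] => PMF.pure d
      | s :: l =>
          (exploreActions G K s (Finset.univ : Finset (∀ i, A i)).toList
            { d with queue := l }).bind (bfsLoop G K r)

/-- `BFS-Estimate` with `K` samples for each explored state-action pair. It returns the estimated
transition function. Every state enters the queue at most once, so `|S|` rounds empty it. -/
noncomputable def bfsEstimate {n : ℕ} {S : Type*} {A : Fin n → Type*} [Fintype S]
    [∀ i, Fintype (A i)] (G : MarkovGame n S A) (K : ℕ) : PMF (S → (∀ i, A i) → S → ℝ) :=
  (bfsLoop G K (Fintype.card S) ⟨{G.s₀}, [G.s₀], fun _ _ _ => 0⟩).map BFSState.est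

/-- The number `K` of samples, where `M` and `Q` are the maximal numbers of memory states and of
reward machine states. -/
noncomputable def sampleSize {n : ℕ} (S : Type*) (A : Fin n → Type*) [Fintype S]
    [∀ i, Fintype (A i)] (H M Q : ℕ) (δ p : ℝ) : ℕ :=
  ⌈2 * (Fintype.card S : ℝ) ^ 2 * (M : ℝ) ^ 2 * (Q : ℝ) ^ 2 * (H : ℝ) ^ 4 / δ ^ 2 *
    Real.log (2 * (Fintype.card S : ℝ) ^ 2 * (Fintype.card (∀ i, A i) : ℝ) / p)⌉₊

/-! ## The search algorithm -/

/-- A choice of a coalition policy in the punishment game of each agent `j` with respect to each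
candidate policy `π` over each model with transition function `P`. -/
abbrev Solver {n : ℕ} {AP : Type*} (S : Type*) (A : Fin n → Type*) (φ : Fin n → Spec AP) :=
  ∀ (_ : S → (∀ i, A i) → S → ℝ) (π : FSPolicy S A) (j : Fin n), MinPolicy π (φ j).Q j

/-- The solver picks an element of the `arg min` whenever that set is nonempty. -/
def Solver.IsExact {n : ℕ} {S AP : Type*} {A : Fin n → Type*} [Fintype S] [∀ i, Fintype (A i)]
    {φ : Fin n → Spec AP} (solve : Solver S A φ) (G : MarkovGame n S A)
    (I : AP → S → Bool) : Prop :=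
  ∀ (P : S → (∀ i, A i) → S → ℝ) (π : FSPolicy S A) (j : Fin n),
    (∃ π₂, IsArgMin G.H G.s₀ P π j ((φ j).rm I (∀ i, A i)) π₂) →
      IsArgMin G.H G.s₀ P π j ((φ j).rm I (∀ i, A i)) (solve P π j)

/-- The check of `VerifyNash` for the candidate `π` and the estimated transition function `P`. -/
def verifyNash {n : ℕ} {S AP : Type*} {A : Fin n → Type*} [Fintype S] [∀ i, Fintype (A i)]
    (G : MarkovGame n S A) (I : AP → S → Bool) (φ : Fin n → Spec AP) (ε δ : ℝ)
    (P : S → (∀ i, A i) → S → ℝ) (π : FSPolicy S A) : Prop :=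
  ∀ j, minMaxValue G.H G.s₀ P π j ((φ j).rm I (∀ i, A i)) ≤
    score G I (φ j) π.toProfile + ε - δ

/-- The punishment strategies computed by `VerifyNash`. -/
noncomputable def verifyNashPunishment {n : ℕ} {S AP : Type*} {A : Fin n → Type*}
    (I : AP → S → Bool) (φ : Fin n → Spec AP) (solve : Solver S A φ)
    (P : S → (∀ i, A i) → S → ℝ) (π : FSPolicy S A) : Punishment S A :=
  fun j => punStrat π j ((φ j).rm I (∀ i, A i)) (solve P π j)

open Classical in
/-- Return `π ⋈ τ` for the first candidate `π` that passes the verification, if there is one. -/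
noncomputable def searchList {n : ℕ} {S AP : Type*} {A : Fin n → Type*} [Fintype S]
    [∀ i, Fintype (A i)] (G : MarkovGame n S A) (I : AP → S → Bool) (φ : Fin n → Spec AP)
    (solve : Solver S A φ) (ε δ : ℝ) (P : S → (∀ i, A i) → S → ℝ) :
    List (FSPolicy S A) → Option (Profile S A)
  | [] => none
  | π :: l =>
      if verifyNash G I φ ε δ P π then some (π.join (verifyNashPunishment I φ solve P π))
      else searchList G I φ solve ε δ P l

/-- `HighNashSearch`: draw the list of candidate policies with the (randomized) procedure
`enumerate`, estimate the model once with fresh samples, and verify the candidates in order. -/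
noncomputable def highNashSearch {n : ℕ} {S AP : Type*} {A : Fin n → Type*} [Fintype S]
    [∀ i, Fintype (A i)] (G : MarkovGame n S A) (I : AP → S → Bool) (φ : Fin n → Spec AP)
    (enumerate : PMF (List (FSPolicy S A))) (solve : Solver S A φ) (ε δ p : ℝ) :
    PMF (Option (Profile S A)) :=
  enumerate.bind fun l =>
    (bfsEstimate G (sampleSize S A G.H ((l.map FSPolicy.mem).foldr max 0)
      (Finset.univ.sup fun j => Fintype.card (φ j).Q) δ p)).map fun P =>
        searchList G I φ solve ε δ P l

end SpecNash

open SpecNash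

set_option linter.unusedSectionVars false

namespace SpecNash

/-! ## Correctness of the automata -/

section Automata

variable {S Q Q₁ Q₂ : Type*}

/-! Fix an agent `j` and a deviation `π'`. As `π` is deterministic, a departure by `j` is visible at
once, and as the others follow `π` until then, `j` is the first deviator if anybody is. So the play
in which `j` replaces its part of `π ⋈ τ` by `π'` is a play of the punishment game: before the
deviation both force the others to follow `π`, afterwards both let the coalition use its minimizer
(`gameExp_ann`). The rewards telescope to the indicator of satisfaction, because the initial state
of the automaton is not accepting (`sum_rewards_ann_snoc`). Hence over the estimated model every
deviation scores at most the min-max value (`IsStochastic.gameValue_eq`), which is attained by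
compactness (`exists_isArgMin`). Without deviations `π ⋈ τ` is just `π` (`score_join`).

To pass to the true model: the expectation of a function with values in `[0, 1]` after `H` steps
changes by at most `H` times the largest `ℓ¹` error of a row. With entrywise error `η` and `H |S| η
≤ δ`, the true score of the deviation is at most the min-max value plus `δ`, hence at most the score
of `π` plus `ε`. Memory and automaton states cost nothing, being functions of the trajectory. Rows
of undiscovered states are not estimated, but the discovered states contain `s₀` and are closed
under the estimated transitions, so the other rows may be replaced by the true ones
(`IsAccurate.isEpsNash_join`).

Accuracy follows from Hoeffding's inequality for each frequency (`toOuterMeasure_freq_le`) and a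
union bound over at most `|S| |A| |S|` entries, carried through the adaptive search by the invariant
`BFSInvariant`. The accuracy event does not mention the candidates, so a single estimate serves a
whole list, and it remains to average over the random list. -/

theorem achieveDFA_eval (b : S → Bool) (w : List S) :
    (achieveDFA b).eval w = true ↔ ∃ s ∈ w, b s = true := by
  induction w using List.reverseRecOn with
  | nil => simp [achieveDFA]
  | append_singleton w s ih =>
    rw [DFA.eval_append_singleton]
    have : (achieveDFA b).step ((achieveDFA b).eval w) s = ((achieveDFA b).eval w || b s) := rfl
    rw [this, Bool.or_eq_true, ih]
    simp only [List.mem_append, List.mem_singleton]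
    constructor
    · rintro (⟨x, hx, h⟩ | h)
      · exact ⟨x, Or.inl hx, h⟩
      · exact ⟨s, Or.inr rfl, h⟩
    · rintro ⟨x, hx | rfl, h⟩
      · exact Or.inl ⟨x, hx, h⟩
      · exact Or.inr h

theorem ensuringDFA_eval (D : DFA S Q) (b : S → Bool) (w : List S) (q : Q) :
    (ensuringDFA D b).eval w = some q ↔ D.eval w = q ∧ ∀ s ∈ w, b s = true := by
  induction w using List.reverseRecOn generalizing q with
  | nil => simp [ensuringDFA]
  | append_singleton w s ih =>
    rw [DFA.eval_append_singleton, DFA.eval_append_singleton]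
    have : (ensuringDFA D b).step ((ensuringDFA D b).eval w) s =
      ((ensuringDFA D b).eval w).bind fun q => if b s then some (D.step q s) else none := rfl
    rw [this, Option.bind_eq_some_iff]
    constructor
    · rintro ⟨a, ha, h⟩
      obtain ⟨rfl, hw⟩ := (ih a).1 ha
      split_ifs at h with hs
      refine ⟨Option.some.inj h, fun x hx => ?_⟩
      rcases List.mem_append.1 hx with hx | hx
      · exact hw x hx
      · rw [List.mem_singleton.1 hx]; exact hs
    · rintro ⟨rfl, h⟩
      refine ⟨D.eval w, (ih _).2 ⟨rfl, fun x hx => h x (by simp [hx])⟩, ?_⟩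
      rw [if_pos (h s (by simp))]

/-- The first automaton keeps running as a deterministic copy, whatever runs have been diverted. -/
theorem inl_mem_seqNFA_eval (D₁ : DFA S Q₁) (D₂ : DFA S Q₂) (w : List S) (q : Q₁) :
    (Sum.inl q : Q₁ ⊕ Q₂) ∈ (seqNFA D₁ D₂).toDFA.eval w ↔ q = D₁.eval w := by
  induction w using List.reverseRecOn generalizing q with
  | nil => simp [seqNFA, NFA.toDFA]
  | append_singleton w s ih =>
    rw [DFA.eval_append_singleton, DFA.eval_append_singleton]
    have : (seqNFA D₁ D₂).toDFA.step ((seqNFA D₁ D₂).toDFA.eval w) s =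
      (seqNFA D₁ D₂).stepSet ((seqNFA D₁ D₂).toDFA.eval w) s := rfl
    rw [this, NFA.mem_stepSet]
    constructor
    · rintro ⟨x | x, hx, h⟩
      · rw [ih] at hx
        subst hx
        simpa [seqNFA] using h
      · simp [seqNFA] at h
    · rintro rfl
      exact ⟨Sum.inl (D₁.eval w), (ih _).2 rfl, by simp [seqNFA]⟩

/-- Each cut of the word starts its own run of the second automaton. Diversion happens on a
transition, so the first part is nonempty even if the first automaton accepted the empty word. -/
theorem inr_mem_seqNFA_eval (D₁ : DFA S Q₁) (D₂ : DFA S Q₂) (w : List S) (q : Q₂) :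
    (Sum.inr q : Q₁ ⊕ Q₂) ∈ (seqNFA D₁ D₂).toDFA.eval w ↔
      ∃ u v, w = u ++ v ∧ u ≠ [] ∧ D₁.eval u ∈ D₁.accept ∧ q = D₂.eval v := by
  induction w using List.reverseRecOn generalizing q with
  | nil =>
    simp only [DFA.eval_nil]
    constructor
    · intro h; simp [seqNFA, NFA.toDFA] at h
    · rintro ⟨u, v, h, hu, -⟩
      exact absurd (List.append_eq_nil_iff.1 h.symm).1 hu
  | append_singleton w s ih =>
    rw [DFA.eval_append_singleton]
    have : (seqNFA D₁ D₂).toDFA.step ((seqNFA D₁ D₂).toDFA.eval w) s =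
      (seqNFA D₁ D₂).stepSet ((seqNFA D₁ D₂).toDFA.eval w) s := rfl
    rw [this, NFA.mem_stepSet]
    constructor
    · rintro ⟨x | x, hx, h⟩
      · rw [inl_mem_seqNFA_eval] at hx
        subst hx
        have h' : D₁.step (D₁.eval w) s ∈ D₁.accept ∧ q = D₂.start := by
          simpa [seqNFA] using h
        exact ⟨w ++ [s], [], by simp, by simp, by simpa using h'.1, by simpa using h'.2⟩
      · obtain ⟨u, v, rfl, hu, ha, rfl⟩ := (ih x).1 hx
        refine ⟨u, v ++ [s], by simp, hu, ha, ?_⟩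
        rw [DFA.eval_append_singleton]
        simpa [seqNFA] using h
    · rintro ⟨u, v, huv, hu, ha, rfl⟩
      rcases List.eq_nil_or_concat v with rfl | ⟨v', s', rfl⟩
      · rw [List.append_nil] at huv
        subst huv
        refine ⟨Sum.inl (D₁.eval w), (inl_mem_seqNFA_eval _ _ _ _).2 rfl, ?_⟩
        rw [DFA.eval_append_singleton] at ha
        simp [seqNFA, ha]
      · rw [List.concat_eq_append, ← List.append_assoc] at huv
        obtain ⟨rfl, h2⟩ := List.append_inj' huv rfl
        obtain rfl : s = s' := by simpa using h2
        refine ⟨Sum.inr (D₂.eval v'), (ih _).2 ⟨u, v', rfl, hu, ha, rfl⟩, ?_⟩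
        simp [seqNFA]

theorem mem_choiceNFA_eval (D₁ : DFA S Q₁) (D₂ : DFA S Q₂) (w : List S) (x : Q₁ ⊕ Q₂) :
    x ∈ (choiceNFA D₁ D₂).toDFA.eval w ↔ x = .inl (D₁.eval w) ∨ x = .inr (D₂.eval w) := by
  induction w using List.reverseRecOn generalizing x with
  | nil => simp [choiceNFA, NFA.toDFA]
  | append_singleton w s ih =>
    rw [DFA.eval_append_singleton, DFA.eval_append_singleton, DFA.eval_append_singleton]
    have : (choiceNFA D₁ D₂).toDFA.step ((choiceNFA D₁ D₂).toDFA.eval w) s =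
      (choiceNFA D₁ D₂).stepSet ((choiceNFA D₁ D₂).toDFA.eval w) s := rfl
    rw [this, NFA.mem_stepSet]
    simp only [ih]
    simp [choiceNFA, or_and_right, exists_or]

end Automata

/-! ### Specifications and their automata -/

section Specifications

variable {AP S : Type*} (I : AP → S → Bool)

/-- Used twice: it makes the second part of a cut nonempty, and it keeps the initial state out of
the accepting set, so that the telescoped rewards start from `0`. -/
theorem Spec.not_sat_nil (φ : Spec AP) : ¬ φ.Sat I [] := by
  induction φ with
  | achieve b => simp [Spec.Sat]
  | ensuring φ b ih => exact fun h => ih h.1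
  | seq φ₁ φ₂ ih₁ ih₂ => simp [Spec.Sat]
  | choice φ₁ φ₂ ih₁ ih₂ => exact fun h => h.elim ih₁ ih₂

/-- The automaton of a specification accepts the state sequences satisfying it. -/
theorem Spec.dfa_eval_mem_accept (φ : Spec AP) (w : List S) :
    (φ.dfa I).eval w ∈ (φ.dfa I).accept ↔ φ.Sat I w := by
  induction φ generalizing w with
  | achieve b => exact achieveDFA_eval (b.eval I) w
  | ensuring φ b ih =>
    change (ensuringDFA (φ.dfa I) (b.eval I)).eval w ∈ some '' (φ.dfa I).accept ↔
      φ.Sat I w ∧ ∀ s ∈ w, b.eval I s = true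
    rw [← ih]
    constructor
    · rintro ⟨q, hq, h⟩
      obtain ⟨rfl, hw⟩ := (ensuringDFA_eval _ _ _ _).1 h.symm
      exact ⟨hq, hw⟩
    · rintro ⟨hq, hw⟩
      exact ⟨_, hq, ((ensuringDFA_eval _ _ _ _).2 ⟨rfl, hw⟩).symm⟩
  | seq φ₁ φ₂ ih₁ ih₂ =>
    change (∃ x ∈ (seqNFA (φ₁.dfa I) (φ₂.dfa I)).toDFA.eval w, x ∈ Sum.inr '' (φ₂.dfa I).accept) ↔
      ∃ i, i + 1 < w.length ∧ φ₁.Sat I (w.take (i + 1)) ∧ φ₂.Sat I (w.drop (i + 1))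
    constructor
    · rintro ⟨x, hx, q, hq, rfl⟩
      obtain ⟨u, v, rfl, hu, ha, rfl⟩ := (inr_mem_seqNFA_eval _ _ _ _).1 hx
      rw [ih₁] at ha
      rw [ih₂] at hq
      -- The automaton permits a cut at the very end, the semantics does not.
      have hv : v ≠ [] := fun h => φ₂.not_sat_nil I (h ▸ hq)
      have hu' := List.length_pos_iff.2 hu
      have hv' := List.length_pos_iff.2 hv
      have e : u.length - 1 + 1 = u.length := by omega
      refine ⟨u.length - 1, by rw [List.length_append]; omega, ?_, ?_⟩
      · rw [e, List.take_left]; exact ha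
      · rw [e, List.drop_left]; exact hq
    · rintro ⟨i, hi, h₁, h₂⟩
      refine ⟨_, (inr_mem_seqNFA_eval _ _ _ _).2
        ⟨w.take (i + 1), w.drop (i + 1), (List.take_append_drop _ _).symm, ?_, (ih₁ _).2 h₁, rfl⟩,
        _, (ih₂ _).2 h₂, rfl⟩
      intro h
      exact φ₁.not_sat_nil I (h ▸ h₁)
  | choice φ₁ φ₂ ih₁ ih₂ =>
    change (∃ x ∈ (choiceNFA (φ₁.dfa I) (φ₂.dfa I)).toDFA.eval w,
      x ∈ Sum.inl '' (φ₁.dfa I).accept ∪ Sum.inr '' (φ₂.dfa I).accept) ↔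
        φ₁.Sat I w ∨ φ₂.Sat I w
    simp only [mem_choiceNFA_eval, ← ih₁, ← ih₂]
    simp [or_and_right, exists_or]

theorem Spec.dfa_start_notMem_accept (φ : Spec AP) : (φ.dfa I).start ∉ (φ.dfa I).accept :=
  fun h => φ.not_sat_nil I ((φ.dfa_eval_mem_accept I []).1 h)

end Specifications

/-! ## Expectations over trajectories -/

section Expectations

theorem sum_toReal_eq_one {B : Type*} [Fintype B] (μ : PMF B) : ∑ b, (μ b).toReal = 1 := by
  rw [← ENNReal.toReal_sum fun b _ => μ.apply_ne_top b, ← tsum_fintype (L := .unconditional _),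
    μ.tsum_coe, ENNReal.toReal_one]

variable {n : ℕ} {S : Type*} {A : Fin n → Type*} [Fintype S] [∀ i, Fintype (A i)]

/-- The expectation of `F` over the trajectories obtained after one more step. -/
noncomputable def evalStep (P : S → (∀ i, A i) → S → ℝ) (μ : Profile S A)
    (F : Traj S (∀ i, A i) → ℝ) (ζ : Traj S (∀ i, A i)) : ℝ :=
  ∑ a, (∏ i, (μ i ζ (a i)).toReal) * ∑ s, P ζ.last a s * F (ζ.snoc a s)

/-- All rows of `P` are probability vectors. -/
def IsStochastic (P : S → (∀ i, A i) → S → ℝ) : Prop :=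
  (∀ s a s', 0 ≤ P s a s') ∧ ∀ s a, ∑ s', P s a s' = 1

theorem MarkovGame.isStochastic (G : MarkovGame n S A) :
    IsStochastic fun s a s' => (G.P s a s').toReal :=
  ⟨fun _ _ _ => ENNReal.toReal_nonneg, fun s a => sum_toReal_eq_one (G.P s a)⟩

theorem sum_weights (μ : Profile S A) (ζ : Traj S (∀ i, A i)) :
    ∑ a : ∀ i, A i, ∏ i, (μ i ζ (a i)).toReal = 1 := by
  rw [← Fintype.prod_sum fun i c => (μ i ζ c).toReal]
  exact Finset.prod_eq_one fun i _ => sum_toReal_eq_one _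

theorem weights_nonneg (μ : Profile S A) (ζ : Traj S (∀ i, A i)) (a : ∀ i, A i) :
    0 ≤ ∏ i, (μ i ζ (a i)).toReal :=
  Finset.prod_nonneg fun _ _ => ENNReal.toReal_nonneg

variable {P : S → (∀ i, A i) → S → ℝ}

/-- Besides giving bounds, this discards the extra last step of the punishment game, on which the
rewards do not depend. -/
theorem IsStochastic.evalStep_eq (hP : IsStochastic P) (μ : Profile S A)
    {F : Traj S (∀ i, A i) → ℝ} {ζ : Traj S (∀ i, A i)} {c : ℝ}
    (h : ∀ a s, F (ζ.snoc a s) = c) : evalStep P μ F ζ = c := by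
  simp only [evalStep, h, ← Finset.sum_mul, hP.2, one_mul, sum_weights]

theorem IsStochastic.evalStep_mono (hP : IsStochastic P) (μ : Profile S A)
    {F F' : Traj S (∀ i, A i) → ℝ} (h : F ≤ F') : evalStep P μ F ≤ evalStep P μ F' := fun _ =>
  Finset.sum_le_sum fun _ _ => mul_le_mul_of_nonneg_left
    (Finset.sum_le_sum fun _ _ => mul_le_mul_of_nonneg_left (h _) (hP.1 _ _ _))
    (weights_nonneg _ _ _)

theorem IsStochastic.iterate_evalStep_mem_Icc (hP : IsStochastic P) (μ : Profile S A)
    {F : Traj S (∀ i, A i) → ℝ} (hF : ∀ ζ, F ζ ∈ Set.Icc (0 : ℝ) 1) (t : ℕ)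
    (ζ : Traj S (∀ i, A i)) : (evalStep P μ)^[t] F ζ ∈ Set.Icc (0 : ℝ) 1 := by
  induction t generalizing ζ with
  | zero => exact hF ζ
  | succ t ih =>
    rw [Function.iterate_succ_apply']
    constructor
    · have := hP.evalStep_mono μ (F := fun _ => 0) (fun ζ => (ih ζ).1) ζ
      rwa [hP.evalStep_eq μ (F := fun _ => 0) (c := 0) fun _ _ => rfl] at this
    · have := hP.evalStep_mono μ (F := (evalStep P μ)^[t] F) (F' := fun _ => 1) (fun ζ => (ih ζ).2) ζ
      rwa [hP.evalStep_eq μ (F := fun _ => 1) (c := 1) fun _ _ => rfl] at this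

/-- The expectations under two transition functions with close rows are close. -/
theorem IsStochastic.abs_iterate_evalStep_sub_le (hP : IsStochastic P)
    {P' : S → (∀ i, A i) → S → ℝ} (hP' : IsStochastic P') {κ : ℝ}
    (hκ : ∀ s a, ∑ s', |P s a s' - P' s a s'| ≤ κ) (μ : Profile S A)
    {F : Traj S (∀ i, A i) → ℝ} (hF : ∀ ζ, F ζ ∈ Set.Icc (0 : ℝ) 1) (t : ℕ)
    (ζ : Traj S (∀ i, A i)) :
    |(evalStep P μ)^[t] F ζ - (evalStep P' μ)^[t] F ζ| ≤ t * κ := by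
  induction t generalizing ζ with
  | zero => simp
  | succ t ih =>
    rw [Function.iterate_succ_apply', Function.iterate_succ_apply']
    set X := (evalStep P μ)^[t] F with hX
    set Y := (evalStep P' μ)^[t] F
    have hX1 : ∀ ζ, |X ζ| ≤ 1 := fun ζ => by
      obtain ⟨h0, h1⟩ := hP.iterate_evalStep_mem_Icc μ hF t ζ
      rw [abs_of_nonneg h0]
      exact h1
    have row : ∀ a, |∑ s, P ζ.last a s * X (ζ.snoc a s) - ∑ s, P' ζ.last a s * Y (ζ.snoc a s)| ≤
        (t + 1) * κ := fun a => by
      rw [← Finset.sum_sub_distrib]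
      refine (Finset.abs_sum_le_sum_abs _ _).trans ?_
      calc ∑ s, |P ζ.last a s * X (ζ.snoc a s) - P' ζ.last a s * Y (ζ.snoc a s)|
          ≤ ∑ s, (|P ζ.last a s - P' ζ.last a s| + P' ζ.last a s * (t * κ)) := by
            refine Finset.sum_le_sum fun s _ => ?_
            -- The first term is the error of the current row, as `|X| ≤ 1`; the second is a
            -- `P'`-average of the error of the remaining `t` steps.
            have e : P ζ.last a s * X (ζ.snoc a s) - P' ζ.last a s * Y (ζ.snoc a s) =
              (P ζ.last a s - P' ζ.last a s) * X (ζ.snoc a s) +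
                P' ζ.last a s * (X (ζ.snoc a s) - Y (ζ.snoc a s)) := by ring
            rw [e]
            refine (abs_add_le _ _).trans (add_le_add ?_ ?_)
            · rw [abs_mul]
              exact mul_le_of_le_one_right (abs_nonneg _) (hX1 _)
            · rw [abs_mul, abs_of_nonneg (hP'.1 _ _ _)]
              exact mul_le_mul_of_nonneg_left (ih _) (hP'.1 _ _ _)
        _ ≤ (t + 1) * κ := by
            rw [Finset.sum_add_distrib, ← Finset.sum_mul, hP'.2]
            linarith [hκ ζ.last a]
    unfold evalStep
    rw [← Finset.sum_sub_distrib]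
    refine (Finset.abs_sum_le_sum_abs _ _).trans ?_
    calc ∑ a : ∀ i, A i, |(∏ i, (μ i ζ (a i)).toReal) * ∑ s, P ζ.last a s * X (ζ.snoc a s) -
          (∏ i, (μ i ζ (a i)).toReal) * ∑ s, P' ζ.last a s * Y (ζ.snoc a s)|
        ≤ ∑ a : ∀ i, A i, (∏ i, (μ i ζ (a i)).toReal) * ((t + 1) * κ) := by
          refine Finset.sum_le_sum fun a _ => ?_
          rw [← mul_sub, abs_mul, abs_of_nonneg (weights_nonneg _ _ _)]
          exact mul_le_mul_of_nonneg_left (row a) (weights_nonneg _ _ _)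
      _ = ((t + 1 : ℕ) : ℝ) * κ := by
          rw [← Finset.sum_mul, sum_weights, one_mul]
          push_cast
          ring

open ENNReal in
theorem tsum_bind_mul {α β : Type*} (p : PMF α) (f : α → PMF β) (F : β → ℝ≥0∞) :
    ∑' b, (p.bind f) b * F b = ∑' a, p a * ∑' b, f a b * F b := by
  simp only [PMF.bind_apply, ← ENNReal.tsum_mul_right, ← ENNReal.tsum_mul_left, mul_assoc]
  exact ENNReal.tsum_comm

open ENNReal in
theorem tsum_map_mul {α β : Type*} (p : PMF α) (f : α → β) (F : β → ℝ≥0∞) :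
    ∑' b, (p.map f) b * F b = ∑' a, p a * F (f a) := by
  rw [PMF.map, tsum_bind_mul]
  refine tsum_congr fun a => ?_
  rw [tsum_eq_single (f a)]
  · simp
  · intro b hb
    simp [hb]

/-- `trajLaw` is built by appending a last step, which is absorbed into `F`; hence the induction
runs over all nonnegative `F`. -/
theorem tsum_trajLaw (G : MarkovGame n S A) (μ : Profile S A) (t : ℕ)
    {F : Traj S (∀ i, A i) → ℝ} (hF : 0 ≤ F) :
    ∑' ζ, trajLaw G μ t ζ * ENNReal.ofReal (F ζ) =
      ENNReal.ofReal ((evalStep (fun s a s' => (G.P s a s').toReal) μ)^[t] F ⟨[], G.s₀⟩) := by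
  induction t generalizing F with
  | zero =>
    rw [tsum_eq_single (⟨[], G.s₀⟩ : Traj S (∀ i, A i))]
    · simp [trajLaw]
    · intro b hb
      simp [trajLaw, hb]
  | succ t ih =>
    have hnn : 0 ≤ evalStep (fun s a s' => (G.P s a s').toReal) μ F := fun ζ =>
      Finset.sum_nonneg fun a _ => mul_nonneg (weights_nonneg _ _ _)
        (Finset.sum_nonneg fun s _ => mul_nonneg ENNReal.toReal_nonneg (hF _))
    rw [Function.iterate_succ_apply, ← ih hnn]
    rw [trajLaw, tsum_bind_mul]
    refine tsum_congr fun ζ => ?_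
    congr 1
    rw [tsum_bind_mul, tsum_fintype]
    unfold evalStep
    rw [ENNReal.ofReal_sum_of_nonneg fun a _ => mul_nonneg (weights_nonneg _ _ _)
        (Finset.sum_nonneg fun s _ => mul_nonneg ENNReal.toReal_nonneg (hF _))]
    refine Finset.sum_congr rfl fun a _ => ?_
    rw [ENNReal.ofReal_mul (weights_nonneg _ _ _), tsum_map_mul, tsum_fintype,
      ENNReal.ofReal_prod_of_nonneg fun _ _ => ENNReal.toReal_nonneg,
      ENNReal.ofReal_sum_of_nonneg fun s _ => mul_nonneg ENNReal.toReal_nonneg (hF _)]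
    congr 1
    · simp only [prodPMF, PMF.ofFintype_apply]
      exact Finset.prod_congr rfl fun i _ => (ENNReal.ofReal_toReal ((μ i ζ).apply_ne_top _)).symm
    · refine Finset.sum_congr rfl fun s _ => ?_
      rw [ENNReal.ofReal_mul ENNReal.toReal_nonneg, ENNReal.ofReal_toReal ((G.P _ _).apply_ne_top _)]

open Classical in
/-- The indicator function of the trajectories satisfying a specification. -/
noncomputable def satInd {AP : Type*} (I : AP → S → Bool) (φ : Spec AP)
    (ζ : Traj S (∀ i, A i)) : ℝ :=
  if φ.Sat I ζ.states then 1 else 0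

theorem satInd_mem_Icc {AP : Type*} (I : AP → S → Bool) (φ : Spec AP) (ζ : Traj S (∀ i, A i)) :
    satInd I φ ζ ∈ Set.Icc (0 : ℝ) 1 := by
  unfold satInd
  split_ifs <;> simp

theorem score_eq_iterate {AP : Type*} (G : MarkovGame n S A) (I : AP → S → Bool) (φ : Spec AP)
    (μ : Profile S A) :
    score G I φ μ =
      (evalStep (fun s a s' => (G.P s a s').toReal) μ)^[G.H] (satInd I φ) ⟨[], G.s₀⟩ := by
  have h := tsum_trajLaw G μ G.H (F := satInd I φ) fun ζ => (satInd_mem_Icc I φ ζ).1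
  rw [score, PMF.toOuterMeasure_apply, ← ENNReal.toReal_ofReal
    (G.isStochastic.iterate_evalStep_mem_Icc μ (satInd_mem_Icc I φ) G.H ⟨[], G.s₀⟩).1, ← h]
  congr 1
  refine tsum_congr fun ζ => ?_
  by_cases hζ : φ.Sat I ζ.states
  · simp [satInd, hζ]
  · simp [satInd, hζ]

end Expectations

/-! ## The punishment game and the deviations from `π ⋈ τ` -/

section Game

variable {n : ℕ} {S Q : Type*} {A : Fin n → Type*}

/-- The trajectory of the game underlying a trajectory of the punishment game. -/
def forget {π : FSPolicy S A} (ζ : PTraj π Q) : Traj S (∀ i, A i) :=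
  ⟨ζ.hist.map fun xa => (xa.1.1, xa.2), ζ.last.1⟩

variable (π : FSPolicy S A) (j : Fin n) (R : RewardMachine S (∀ i, A i) Q)

theorem annotate_last_fst (m : Fin π.mem) (q : Q) (b : Bool) (h : List (S × (∀ i, A i))) (t : S) :
    (annotate π j R m q b h t).last.1 = t := by
  induction h generalizing m q b with
  | nil => rfl
  | cons sa h ih => exact ih _ _ _

theorem annotate_last_memory (m : Fin π.mem) (q : Q) (b : Bool) (h : List (S × (∀ i, A i)))
    (t : S) :
    (annotate π j R m q b h t).last.2.1 = h.foldl (fun m sa => π.α sa.1 sa.2 m) m := by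
  induction h generalizing m q b with
  | nil => rfl
  | cons sa h ih => exact ih _ _ _

theorem forget_annotate (m : Fin π.mem) (q : Q) (b : Bool) (h : List (S × (∀ i, A i))) (t : S) :
    forget (annotate π j R m q b h t) = ⟨h, t⟩ := by
  induction h generalizing m q b with
  | nil => rfl
  | cons sa h ih =>
    have := ih (π.α sa.1 sa.2 m) (R.δu sa.1 sa.2 q) (devUpdate π j sa.1 sa.2 m b)
    simp only [forget, Traj.mk.injEq] at this
    simp only [forget, annotate, List.map_cons, Traj.mk.injEq, List.cons.injEq, true_and]
    exact this

/-- The annotation recurses from the front, whereas trajectories grow at the end. -/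
theorem annotate_append (m : Fin π.mem) (q : Q) (b : Bool) (h : List (S × (∀ i, A i)))
    (s : S) (a : ∀ i, A i) (t : S) :
    annotate π j R m q b (h ++ [(s, a)]) t =
      (annotate π j R m q b h s).snoc a (t, π.α s a (annotate π j R m q b h s).last.2.1,
        R.δu s a (annotate π j R m q b h s).last.2.2.1,
        devUpdate π j s a (annotate π j R m q b h s).last.2.1
          (annotate π j R m q b h s).last.2.2.2) := by
  induction h generalizing m q b with
  | nil => rfl
  | cons sa h ih =>
    have := ih (π.α sa.1 sa.2 m) (R.δu sa.1 sa.2 q) (devUpdate π j sa.1 sa.2 m b)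
    simp only [List.cons_append, annotate, this]
    rfl

theorem devUpdate_congr {s : S} {a a' : ∀ i, A i} (h : a j = a' j) (m : Fin π.mem) (b : Bool) :
    devUpdate π j s a m b = devUpdate π j s a' m b := by
  unfold devUpdate
  rw [h]

theorem execAction_self (x : PState S (Fin π.mem) Q) (a : ∀ i, A i) :
    execAction π j x a j = a j := by
  obtain ⟨s, m, q, b⟩ := x
  cases b <;> simp [execAction]

open Classical in
-- Again the recursion is turned around: an earlier deviation takes precedence, and only without one
-- does the last step count.
theorem firstDeviatorFrom_append (m : Fin π.mem) (h : List (S × (∀ i, A i))) (s : S)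
    (a : ∀ i, A i) :
    π.firstDeviatorFrom m (h ++ [(s, a)]) = (π.firstDeviatorFrom m h).or
      ((List.finRange n).find? fun k =>
        decide (a k ≠ π.σ s (h.foldl (fun m sa => π.α sa.1 sa.2 m) m) k)) := by
  induction h generalizing m with
  | nil =>
    simp only [List.nil_append, FSPolicy.firstDeviatorFrom, List.foldl_nil, Option.none_or]
    split
    · next h => exact h.symm
    · next h => exact h.symm
  | cons sa h ih =>
    obtain ⟨s', a'⟩ := sa
    simp only [List.cons_append, FSPolicy.firstDeviatorFrom, List.foldl_cons, ih]
    split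
    · simp
    · rfl

open Classical in
theorem find_update (σ : ∀ i, A i) (c : A j) :
    ((List.finRange n).find? fun k => decide (Function.update σ j c k ≠ σ k)) =
      if c ≠ σ j then some j else none := by
  have key : ∀ k, k ≠ j → Function.update σ j c k = σ k := fun k hk => by simp [hk]
  cases h : (List.finRange n).find? fun k => decide (Function.update σ j c k ≠ σ k) with
  | none =>
    rw [List.find?_eq_none] at h
    have := h j (List.mem_finRange j)
    rw [if_neg]
    simpa using this
  | some k =>
    have hk := List.find?_some h
    simp only [decide_eq_true_eq] at hk
    have hkj : k = j := by
      by_contra hne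
      exact hk (key k hne)
    subst hkj
    rw [if_pos]
    simpa using hk

/-- The trajectory `ζ` annotated from the initial state of the punishment game. -/
noncomputable abbrev ann (ζ : Traj S (∀ i, A i)) : PTraj π Q :=
  annotate π j R π.m₀ R.q₀ false ζ.hist ζ.last

/-- Nobody but `j` is the first to deviate from `π` along `ζ`. -/
def OnlyDeviator (ζ : Traj S (∀ i, A i)) : Prop :=
  π.firstDeviatorFrom π.m₀ ζ.hist = if (ann π j R ζ).last.2.2.2 = true then some j else none

theorem ann_last (ζ : Traj S (∀ i, A i)) :
    (ann π j R ζ).last =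
      (ζ.last, π.memory ζ.hist, (ann π j R ζ).last.2.2.1, (ann π j R ζ).last.2.2.2) := by
  refine Prod.ext (annotate_last_fst _ _ _ _ _ _ _ _) (Prod.ext ?_ rfl)
  exact annotate_last_memory _ _ _ _ _ _ _ _

theorem ann_snoc (ζ : Traj S (∀ i, A i)) (a : ∀ i, A i) (s : S) :
    ann π j R (ζ.snoc a s) =
      (ann π j R ζ).snoc a (s, π.α ζ.last a (π.memory ζ.hist),
        R.δu ζ.last a (ann π j R ζ).last.2.2.1,
        devUpdate π j ζ.last a (π.memory ζ.hist) (ann π j R ζ).last.2.2.2) := by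
  have := annotate_append π j R π.m₀ R.q₀ false ζ.hist ζ.last a s
  rw [annotate_last_memory] at this
  exact this

theorem onlyDeviator_nil (s : S) : OnlyDeviator π j R ⟨[], s⟩ := rfl

variable {π j R}

/-- The first deviator is settled once and for all, so the action is arbitrary here. -/
theorem OnlyDeviator.snoc_of_deviated {ζ : Traj S (∀ i, A i)} (h : OnlyDeviator π j R ζ)
    (hb : (ann π j R ζ).last.2.2.2 = true) (a : ∀ i, A i) (s : S) :
    OnlyDeviator π j R (ζ.snoc a s) := by
  unfold OnlyDeviator at h ⊢
  rw [ann_snoc]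
  simp only [Traj.snoc, firstDeviatorFrom_append, devUpdate]
  rw [h, hb]
  simp

/-- Before the deviation the invariant survives exactly the actions that the punishment game
executes; ties between deviators cannot occur. -/
theorem OnlyDeviator.snoc_update {ζ : Traj S (∀ i, A i)} (h : OnlyDeviator π j R ζ)
    (hb : (ann π j R ζ).last.2.2.2 = false) (c : A j) (s : S) :
    OnlyDeviator π j R (ζ.snoc (Function.update (π.act ζ) j c) s) := by
  unfold OnlyDeviator at h ⊢
  rw [ann_snoc]
  refine (firstDeviatorFrom_append _ _ _ _ _).trans ?_
  refine (congrArg (Option.or _) (find_update j (π.act ζ) c)).trans ?_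
  rw [h, hb]
  by_cases hc : c = π.σ ζ.last (π.memory ζ.hist) j
  · simp [Traj.snoc, devUpdate, FSPolicy.act, hc]
  · simp only [Traj.snoc, devUpdate, FSPolicy.act, Function.update_self]
    simp [hc]

end Game

/-! ### Punishment game plays as plays of the original game -/

section Reduction

variable {n : ℕ} {S Q : Type*} {A : Fin n → Type*} [Fintype S] [Fintype Q]
  [∀ i, Fintype (A i)] (P : S → (∀ i, A i) → S → ℝ) (π : FSPolicy S A) (j : Fin n)
  (R : RewardMachine S (∀ i, A i) Q)

/-- Memory, automaton state and flag move deterministically, so only the successor in `S` is random.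
This is why the sizes of `M` and `Q` do not enter the error. -/
theorem sum_gameP_mul (s : S) (m : Fin π.mem) (q : Q) (b : Bool) (a : ∀ i, A i)
    (G : PState S (Fin π.mem) Q → ℝ) :
    ∑ x', gameP P π j R (s, m, q, b) a x' * G x' =
      ∑ s', P s (execAction π j (s, m, q, b) a) s' *
        G (s', π.α s (execAction π j (s, m, q, b) a) m, R.δu s (execAction π j (s, m, q, b) a) q,
          devUpdate π j s a m b) := by
  rw [Fintype.sum_prod_type]
  refine Finset.sum_congr rfl fun s' _ => ?_
  rw [Finset.sum_eq_single (π.α s (execAction π j (s, m, q, b) a) m,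
    R.δu s (execAction π j (s, m, q, b) a) q, devUpdate π j s a m b)]
  · simp [gameP]
  · rintro ⟨m', q', b'⟩ - hne
    simp only [gameP]
    rw [if_neg, zero_mul]
    rintro ⟨rfl, rfl, rfl⟩
    exact hne rfl
  · simp

/-- Summing out the actions of all agents but one. -/
theorem sum_prod_mul_apply {f : ∀ i, A i → ℝ} (hf : ∀ i, i ≠ j → ∑ c, f i c = 1)
    (g : A j → ℝ) : ∑ a : ∀ i, A i, (∏ i, f i (a i)) * g (a j) = ∑ c, f j c * g c := by
  -- Absorb `g` into the factor of `j` and expand the product of sums; the other factors sum to `1`.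
  have h := Fintype.prod_sum
    (Function.update f j fun c => f j c * g c : ∀ i, A i → ℝ)
  rw [Fintype.prod_eq_mul_prod_subtype_ne _ j] at h
  rw [Function.update_self, Finset.prod_eq_one, mul_one] at h
  · rw [h]
    refine Finset.sum_congr rfl fun a _ => ?_
    rw [Fintype.prod_eq_mul_prod_subtype_ne _ j, Fintype.prod_eq_mul_prod_subtype_ne _ j,
      Function.update_self, mul_right_comm]
    congr 1
    refine Finset.prod_congr rfl fun i _ => ?_
    rw [Function.update_of_ne i.2]
  · intro i _
    rw [Function.update_of_ne i.2]
    exact hf i i.2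

variable {P π j R}

open Classical in
/-- The expectations in the punishment game are those of the game played with the profile in which
`j` deviates from `π ⋈ τ`. -/
theorem gameExp_ann (π₁ : MaxPolicy π Q j) (π₂ : MinPolicy π Q j) {τ : Punishment S A}
    (hτ : τ j = punStrat π j R π₂) (F : PTraj π Q → ℝ) (t : ℕ) {ζ : Traj S (∀ i, A i)}
    (hζ : OnlyDeviator π j R ζ) :
    gameExp P π j R π₁ π₂ F t (ann π j R ζ) =
      (evalStep P (Function.update (π.join τ) j fun ζ => π₁ (ann π j R ζ)))^[t]
        (fun ζ => F (ann π j R ζ)) ζ := by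
  induction t generalizing ζ with
  | zero => rfl
  | succ t ih =>
    rw [Function.iterate_succ_apply']
    set μ := Function.update (π.join τ) j fun ζ => π₁ (ann π j R ζ) with hμ
    set V := (evalStep P μ)^[t] fun ζ => F (ann π j R ζ)
    have hμj : ∀ ζ c, μ j ζ c = π₁ (ann π j R ζ) c := fun ζ c => by simp [hμ]
    have hμi : ∀ i, i ≠ j → μ i ζ = π.join τ i ζ := fun i hi => by simp [hμ, hi]
    have hinner : ∀ a, (∀ s, OnlyDeviator π j R (ζ.snoc (execAction π j (ann π j R ζ).last a) s)) →
        ∑ x', gameP P π j R (ann π j R ζ).last a x' *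
          gameExp P π j R π₁ π₂ F t
            ((ann π j R ζ).snoc (execAction π j (ann π j R ζ).last a) x') =
        ∑ s, P ζ.last (execAction π j (ann π j R ζ).last a) s *
          V (ζ.snoc (execAction π j (ann π j R ζ).last a) s) := fun a ha => by
      have hl := ann_last π j R ζ
      have h := sum_gameP_mul P π j R ζ.last (π.memory ζ.hist) (ann π j R ζ).last.2.2.1
        (ann π j R ζ).last.2.2.2 a fun x' => gameExp P π j R π₁ π₂ F t
            ((ann π j R ζ).snoc (execAction π j (ann π j R ζ).last a) x')
      rw [← hl] at h
      rw [h]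
      refine Finset.sum_congr rfl fun s _ => ?_
      rw [← ih (ha s), ann_snoc,
        devUpdate_congr π j (execAction_self π j (ann π j R ζ).last a).symm]
    -- The weights become a product over all agents, as needed to sum out the others; the `else`
    -- branch is a filler overwritten by the update at `j`.
    have hw : ∀ a : ∀ i, A i, (π₁ (ann π j R ζ) (a j)).toReal *
        (∏ i : {i : Fin n // i ≠ j}, (π₂ i (ann π j R ζ) (a i)).toReal) =
        ∏ i, (Function.update (fun i => if h : i ≠ j then π₂ ⟨i, h⟩ (ann π j R ζ)
          else μ i ζ) j (π₁ (ann π j R ζ)) i (a i)).toReal := fun a => by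
      rw [Fintype.prod_eq_mul_prod_subtype_ne _ j, Function.update_self]
      congr 1
      refine Finset.prod_congr rfl fun i _ => ?_
      rw [Function.update_of_ne i.2, dif_pos i.2]
    unfold gameExp
    cases hb : (ann π j R ζ).last.2.2.2 with
    | true =>
      have hexec : ∀ a, execAction π j (ann π j R ζ).last a = a := fun a => by
        rw [ann_last, hb]; simp [execAction]
      refine Finset.sum_congr rfl fun a _ => ?_
      rw [hinner a fun s => hζ.snoc_of_deviated hb _ s, hexec]
      congr 1
      rw [Fintype.prod_eq_mul_prod_subtype_ne _ j, hμj]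
      congr 1
      refine Finset.prod_congr rfl fun i _ => ?_
      have hζ' : π.firstDeviatorFrom π.m₀ ζ.hist = some j := by
        have h := hζ
        rw [OnlyDeviator, hb] at h
        simpa using h
      rw [hμi i i.2, FSPolicy.join, hζ']
      simp only [i.2, ne_eq, not_false_eq_true, dif_pos, hτ]
      rfl
    | false =>
      have hexec : ∀ a, execAction π j (ann π j R ζ).last a =
          Function.update (π.act ζ) j (a j) := fun a => by
        rw [ann_last, hb]; simp [execAction, FSPolicy.act]
      have hζ' : π.firstDeviatorFrom π.m₀ ζ.hist = none := by
        have h := hζ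
        rw [OnlyDeviator, hb] at h
        simpa using h
      have hpure : ∀ i, i ≠ j → μ i ζ = PMF.pure (π.act ζ i) := fun i hi => by
        rw [hμi i hi, FSPolicy.join, hζ']
      set g : A j → ℝ := fun c => ∑ s, P ζ.last (Function.update (π.act ζ) j c) s *
          V (ζ.snoc (Function.update (π.act ζ) j c) s) with hg
      -- Both sides reduce to the law of the action of `j` alone: in the punishment game the
      -- coalition's actions are ignored, in the original game the others play `π` with probability
      -- one.
      trans ∑ c, (π₁ (ann π j R ζ) c).toReal * g c
      · have h := sum_prod_mul_apply j (f := fun i c =>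
          (Function.update (fun i => if h : i ≠ j then π₂ ⟨i, h⟩ (ann π j R ζ)
          else μ i ζ) j (π₁ (ann π j R ζ)) i c).toReal) (fun i _ => sum_toReal_eq_one _) g
        rw [Function.update_self] at h
        rw [← h]
        refine Finset.sum_congr rfl fun a _ => ?_
        rw [hinner a fun s => by rw [hexec]; exact hζ.snoc_update hb _ s, hexec, hw]
      · have h := sum_prod_mul_apply j (f := fun i c => (μ i ζ c).toReal)
          (fun i _ => sum_toReal_eq_one _) g
        simp only [hμj] at h
        rw [← h]
        refine Finset.sum_congr rfl fun a _ => ?_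
        by_cases ha : a = Function.update (π.act ζ) j (a j)
        · rw [hg]
          simp only [← ha]
        · have : ∃ i, i ≠ j ∧ a i ≠ π.act ζ i := by
            by_contra hcon
            push Not at hcon
            refine ha (funext fun i => ?_)
            by_cases hi : i = j
            · subst hi; simp
            · simp [hi, hcon i hi]
          obtain ⟨i, hi, hai⟩ := this
          have h0 : ∏ i, (μ i ζ (a i)).toReal = 0 := by
            refine Finset.prod_eq_zero (Finset.mem_univ i) ?_
            rw [hpure i hi, PMF.pure_apply, if_neg hai, ENNReal.toReal_zero]
          rw [h0, zero_mul, zero_mul]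

end Reduction

/-! ### Game values as satisfaction probabilities -/

section Values

variable {n : ℕ} {S AP : Type*} {A : Fin n → Type*} (I : AP → S → Bool) (φ : Spec AP)

open Classical in
-- Each reward is the change of the indicator of the accepting set, so the sum telescopes.
theorem sum_rewards_annotate (π : FSPolicy S A) (j : Fin n) (m : Fin π.mem) (q : φ.Q) (b : Bool)
    (h : List (S × (∀ i, A i))) (t : S) :
    ((annotate π j (φ.rm I (∀ i, A i)) m q b h t).hist.map fun xa =>
        (φ.rm I (∀ i, A i)).δr xa.1.1 xa.1.2.2.1).sum =
      (if (φ.dfa I).evalFrom q (h.map Prod.fst) ∈ (φ.dfa I).accept then 1 else 0) -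
        if q ∈ (φ.dfa I).accept then 1 else 0 := by
  induction h generalizing m q b with
  | nil => simp [annotate]
  | cons sa h ih =>
    have := ih (π.α sa.1 sa.2 m) ((φ.dfa I).step q sa.1) (devUpdate π j sa.1 sa.2 m b)
    have e : (annotate π j (φ.rm I (∀ i, A i)) m q b (sa :: h) t).hist =
      ((sa.1, m, q, b), sa.2) :: (annotate π j (φ.rm I (∀ i, A i)) (π.α sa.1 sa.2 m)
        ((φ.dfa I).step q sa.1) (devUpdate π j sa.1 sa.2 m b) h t).hist := rfl
    rw [e, List.map_cons, List.sum_cons, this, List.map_cons, DFA.evalFrom_cons]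
    simp only [Spec.rm]
    by_cases h1 : q ∈ (φ.dfa I).accept <;> by_cases h2 : (φ.dfa I).step q sa.1 ∈ (φ.dfa I).accept <;>
      simp [h1, h2]
    ring

/-- The automaton reads a state only when that state enters the history, so judging `s₀, …, s_H`
takes `H + 1` steps; what the last step appends is irrelevant. -/
theorem sum_rewards_ann_snoc (π : FSPolicy S A) (j : Fin n) (ζ : Traj S (∀ i, A i))
    (a : ∀ i, A i) (s : S) :
    ((ann π j (φ.rm I (∀ i, A i)) (ζ.snoc a s)).hist.map fun xa =>
        (φ.rm I (∀ i, A i)).δr xa.1.1 xa.1.2.2.1).sum = satInd I φ ζ := by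
  classical
  refine (sum_rewards_annotate I φ π j _ _ _ _ _).trans ?_
  have h1 : (φ.rm I (∀ i, A i)).q₀ = (φ.dfa I).start := rfl
  have h2 : (ζ.snoc a s).hist.map Prod.fst = ζ.states := by simp [Traj.snoc, Traj.states]
  have h3 : (φ.dfa I).evalFrom (φ.dfa I).start ζ.states ∈ (φ.dfa I).accept ↔ φ.Sat I ζ.states :=
    φ.dfa_eval_mem_accept I ζ.states
  rw [h1, h2, if_neg (φ.dfa_start_notMem_accept I), sub_zero, satInd]
  by_cases h : φ.Sat I ζ.states
  · rw [if_pos h, if_pos (h3.2 h)]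
  · rw [if_neg h, if_neg (mt h3.1 h)]

variable [Fintype S] [∀ i, Fintype (A i)] {P : S → (∀ i, A i) → S → ℝ} {π : FSPolicy S A}
  {j : Fin n} {I φ}

/-- The value of the punishment game is the satisfaction probability under the profile in which
`j` deviates from `π ⋈ τ`. -/
theorem IsStochastic.gameValue_eq (hP : IsStochastic P) (H : ℕ) (s₀ : S)
    (π₁ : MaxPolicy π φ.Q j) (π₂ : MinPolicy π φ.Q j) {τ : Punishment S A}
    (hτ : τ j = punStrat π j (φ.rm I (∀ i, A i)) π₂) :
    gameValue H s₀ P π j (φ.rm I (∀ i, A i)) π₁ π₂ =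
      (evalStep P (Function.update (π.join τ) j fun ζ => π₁ (ann π j (φ.rm I (∀ i, A i)) ζ)))^[H]
        (satInd I φ) ⟨[], s₀⟩ := by
  refine (gameExp_ann π₁ π₂ hτ _ (H + 1) (onlyDeviator_nil π j _ s₀)).trans ?_
  rw [Function.iterate_succ_apply]
  refine congrArg (fun F => (evalStep P _)^[H] F _) (funext fun ζ => ?_)
  exact hP.evalStep_eq _ fun a s => sum_rewards_ann_snoc I φ π j ζ a s

theorem IsStochastic.gameValue_mem_Icc (hP : IsStochastic P) (H : ℕ) (s₀ : S)
    (π₁ : MaxPolicy π φ.Q j) (π₂ : MinPolicy π φ.Q j) :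
    gameValue H s₀ P π j (φ.rm I (∀ i, A i)) π₁ π₂ ∈ Set.Icc (0 : ℝ) 1 := by
  -- Only the entry of `τ` at `j` matters; the others are fillers.
  rw [hP.gameValue_eq H s₀ π₁ π₂ (τ := Function.update
    (fun _ i ζ => PMF.pure (π.act ζ i)) j (punStrat π j (φ.rm I (∀ i, A i)) π₂))
    (Function.update_self _ _ _)]
  exact hP.iterate_evalStep_mem_Icc _ (satInd_mem_Icc I φ) _ _

end Values

/-! ### Irrelevance of unreachable rows -/

section Congruence

variable {n : ℕ} {S Q : Type*} {A : Fin n → Type*} [Fintype S] [Fintype Q]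
  [∀ i, Fintype (A i)]

/-- Only the transition probabilities in a closed set of states matter. -/
theorem gameExp_congr {P P' : S → (∀ i, A i) → S → ℝ} {T : Set S}
    (hPP' : ∀ s ∈ T, ∀ a s', P s a s' = P' s a s') (hT : ∀ s ∈ T, ∀ a, ∀ s' ∉ T, P s a s' = 0)
    (π : FSPolicy S A) (j : Fin n) (R : RewardMachine S (∀ i, A i) Q) (π₁ : MaxPolicy π Q j)
    (π₂ : MinPolicy π Q j) (F : PTraj π Q → ℝ) (t : ℕ) (ζ : PTraj π Q) (hζ : ζ.last.1 ∈ T) :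
    gameExp P π j R π₁ π₂ F t ζ = gameExp P' π j R π₁ π₂ F t ζ := by
  induction t generalizing ζ with
  | zero => rfl
  | succ t ih =>
    unfold gameExp
    refine Finset.sum_congr rfl fun a _ => ?_
    congr 1
    refine Finset.sum_congr rfl fun x' _ => ?_
    have e : gameP P π j R ζ.last a x' = gameP P' π j R ζ.last a x' := by
      simp only [gameP, hPP' _ hζ]
    by_cases hx' : x'.1 ∈ T
    · rw [e, ih (ζ.snoc _ x') hx']
    · have h0 : gameP P π j R ζ.last a x' = 0 := by
        simp only [gameP, hT _ hζ _ _ hx', ite_self]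
      rw [← e, h0, zero_mul, zero_mul]

end Congruence

/-! ### Existence of an optimal coalition policy -/

section ArgMin

variable {n : ℕ} {S Q : Type*} {A : Fin n → Type*} [Fintype S] [Fintype Q]
  [∀ i, Fintype (A i)]

/-- The probability mass function with given real weights. -/
noncomputable def simplexPMF {B : Type*} [Fintype B] (x : stdSimplex ℝ B) : PMF B :=
  PMF.ofFintype (fun b => ENNReal.ofReal (x.1 b)) (by
    rw [← ENNReal.ofReal_sum_of_nonneg fun b _ => x.2.1 b, x.2.2, ENNReal.ofReal_one])

theorem simplexPMF_toReal {B : Type*} [Fintype B] (x : stdSimplex ℝ B) (b : B) :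
    (simplexPMF x b).toReal = x.1 b := by
  simp only [simplexPMF, PMF.ofFintype_apply]
  exact ENNReal.toReal_ofReal (x.2.1 b)

theorem simplexPMF_surjective {B : Type*} [Fintype B] :
    Function.Surjective (simplexPMF (B := B)) := fun μ =>
  ⟨⟨fun b => (μ b).toReal, fun _ => ENNReal.toReal_nonneg, sum_toReal_eq_one μ⟩,
    PMF.ext fun b => ENNReal.ofReal_toReal (μ.apply_ne_top b)⟩

/-- With a finite horizon and finitely many moves, this is a polynomial in finitely many of the
coalition's probabilities. -/
theorem continuous_gameExp_simplexPMF (P : S → (∀ i, A i) → S → ℝ) (π : FSPolicy S A) (j : Fin n)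
    (R : RewardMachine S (∀ i, A i) Q) (π₁ : MaxPolicy π Q j) (F : PTraj π Q → ℝ) (t : ℕ)
    (ζ : PTraj π Q) :
    Continuous fun x : ∀ i : {i : Fin n // i ≠ j}, PTraj π Q → stdSimplex ℝ (A i) =>
      gameExp P π j R π₁ (fun i ζ => simplexPMF (x i ζ)) F t ζ := by
  induction t generalizing ζ with
  | zero => exact continuous_const
  | succ t ih =>
    unfold gameExp
    refine continuous_finsetSum _ fun a _ => Continuous.mul (Continuous.mul continuous_const
      (continuous_finsetProd _ fun i _ => ?_))
      (continuous_finsetSum _ fun x' _ => continuous_const.mul (ih _))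
    simp only [simplexPMF_toReal]
    exact (continuous_apply (a i)).comp
      (continuous_subtype_val.comp ((continuous_apply ζ).comp (continuous_apply i)))

/-- The minimum in the definition of the min-max value is attained. -/
theorem exists_isArgMin (H : ℕ) (s₀ : S) (P : S → (∀ i, A i) → S → ℝ) (π : FSPolicy S A)
    (j : Fin n) (R : RewardMachine S (∀ i, A i) Q)
    (hbdd : ∀ π₂, BddAbove (Set.range fun π₁ => gameValue H s₀ P π j R π₁ π₂)) :
    ∃ π₂, IsArgMin H s₀ P π j R π₂ := by
  classical
  -- An action of each agent is supplied by `π` itself.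
  have hne : Nonempty (∀ i : {i : Fin n // i ≠ j}, PTraj π Q → stdSimplex ℝ (A i)) :=
    ⟨fun i ζ => ⟨Pi.single (π.σ s₀ π.m₀ i) 1, single_mem_stdSimplex ℝ _⟩⟩
  -- A supremum of continuous functions is lower semicontinuous, hence attains its minimum on the
  -- product of simplices, which is compact by Tychonoff although there are infinitely many
  -- trajectories.
  have hlsc : LowerSemicontinuous
      fun x : ∀ i : {i : Fin n // i ≠ j}, PTraj π Q → stdSimplex ℝ (A i) =>
        ⨆ π₁, gameValue H s₀ P π j R π₁ fun i ζ => simplexPMF (x i ζ) :=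
    lowerSemicontinuous_ciSup (fun x => hbdd _) fun π₁ =>
      (continuous_gameExp_simplexPMF P π j R π₁ _ _ _).lowerSemicontinuous
  obtain ⟨x, -, hx⟩ := LowerSemicontinuousOn.exists_isMinOn Set.univ_nonempty isCompact_univ
    (hlsc.lowerSemicontinuousOn Set.univ)
  refine ⟨fun i ζ => simplexPMF (x i ζ), fun π₂ => ?_⟩
  choose y hy using fun (i : {i : Fin n // i ≠ j}) (ζ : PTraj π Q) => simplexPMF_surjective (π₂ i ζ)
  have := hx (Set.mem_univ y)
  simpa only [Set.mem_ofPred_eq, hy] using this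

end ArgMin

/-! ### Verified candidates over an accurate model -/

section Soundness

variable {n : ℕ} {S AP : Type*} {A : Fin n → Type*} [Fintype S] [∀ i, Fintype (A i)]

/-- As long as the profile `π ⋈ τ` is followed, it behaves like `π`. -/
theorem score_join (G : MarkovGame n S A) (I : AP → S → Bool) (φ : Spec AP) (π : FSPolicy S A)
    (τ : Punishment S A) : score G I φ (π.join τ) = score G I φ π.toProfile := by
  classical
  rw [score_eq_iterate, score_eq_iterate]
  suffices h : ∀ (t : ℕ) (ζ : Traj S (∀ i, A i)), π.firstDeviatorFrom π.m₀ ζ.hist = none →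
      (evalStep (fun s a s' => (G.P s a s').toReal) (π.join τ))^[t] (satInd I φ) ζ =
        (evalStep (fun s a s' => (G.P s a s').toReal) π.toProfile)^[t] (satInd I φ) ζ from
    h _ _ rfl
  intro t
  induction t with
  | zero => exact fun _ _ => rfl
  | succ t ih =>
    intro ζ hζ
    rw [Function.iterate_succ_apply', Function.iterate_succ_apply']
    have hj : ∀ i, π.join τ i ζ = π.toProfile i ζ := fun i => by
      rw [FSPolicy.join, hζ, FSPolicy.toProfile]
    unfold evalStep
    refine Finset.sum_congr rfl fun a _ => ?_
    simp only [hj]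
    -- The action of `π` creates no deviator, so the induction continues; every other action has
    -- weight `0`.
    by_cases ha : a = π.act ζ
    · congr 1
      refine Finset.sum_congr rfl fun s _ => ?_
      congr 1
      refine ih _ ((firstDeviatorFrom_append _ _ _ _ _).trans ?_)
      rw [hζ, Option.none_or, List.find?_eq_none]
      intro k _
      rw [ha]
      simp [FSPolicy.act, FSPolicy.memory]
    · obtain ⟨i, hi⟩ := Function.ne_iff.1 ha
      have h0 : ∏ i, (π.toProfile i ζ (a i)).toReal = 0 := by
        refine Finset.prod_eq_zero (Finset.mem_univ i) ?_
        rw [FSPolicy.toProfile, PMF.pure_apply, if_neg hi, ENNReal.toReal_zero]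
      rw [h0, zero_mul, zero_mul]

/-- An estimate of the transition probabilities with error at most `η` on a set of states that
contains the initial state and is closed under the estimated transitions. -/
def IsAccurate (G : MarkovGame n S A) (η : ℝ) (P : S → (∀ i, A i) → S → ℝ) : Prop :=
  ∃ T : Set S, G.s₀ ∈ T ∧ ∀ s ∈ T, ∀ a, (∀ s', 0 ≤ P s a s') ∧ ∑ s', P s a s' = 1 ∧
    (∀ s' ∉ T, P s a s' = 0) ∧ ∀ s', |(G.P s a s').toReal - P s a s'| ≤ η

/-- A candidate that passes the verification over an accurate model is an equilibrium when joined
with the computed punishment strategies. -/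
theorem IsAccurate.isEpsNash_join {G : MarkovGame n S A} {η : ℝ} (hη : 0 ≤ η)
    {P : S → (∀ i, A i) → S → ℝ} (hP : IsAccurate G η P) {I : AP → S → Bool}
    {φ : Fin n → Spec AP} {solve : Solver S A φ} (hsolve : solve.IsExact G I) {ε δ : ℝ}
    (hδ : (G.H : ℝ) * (Fintype.card S * η) ≤ δ) {π : FSPolicy S A}
    (hπ : verifyNash G I φ ε δ P π) :
    IsEpsNash G I φ ε (π.join (verifyNashPunishment I φ solve P π)) := by
  classical
  obtain ⟨T, hs₀, hT⟩ := hP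
  -- Outside `T` the estimate need not be stochastic. True rows there make `P'` stochastic with no
  -- added error, and the game started in `T` does not notice.
  set P' : S → (∀ i, A i) → S → ℝ := fun s a s' =>
    if s ∈ T then P s a s' else (G.P s a s').toReal with hP'
  have hP's : IsStochastic P' := by
    constructor
    · intro s a s'
      simp only [hP']
      split_ifs with h
      · exact (hT s h a).1 s'
      · exact ENNReal.toReal_nonneg
    · intro s a
      by_cases h : s ∈ T
      · simpa only [hP', h, if_true] using (hT s h a).2.1
      · simpa only [hP', h, if_false] using G.isStochastic.2 s a
  have hclose : ∀ s a, ∑ s', |(G.P s a s').toReal - P' s a s'| ≤ Fintype.card S * η := by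
    intro s a
    refine (Finset.sum_le_sum fun s' _ => (?_ : _ ≤ η)).trans_eq
      (by rw [Finset.sum_const, Finset.card_univ, nsmul_eq_mul])
    simp only [hP']
    split_ifs with h
    · exact (hT s h a).2.2.2 s'
    · simpa using hη
  intro j π'
  rw [score_join]
  set R := (φ j).rm I (∀ i, A i)
  have hval : ∀ π₁ π₂, gameValue G.H G.s₀ P π j R π₁ π₂ = gameValue G.H G.s₀ P' π j R π₁ π₂ :=
    fun π₁ π₂ => gameExp_congr (T := T) (fun s hs a s' => by simp only [hP', hs, if_true])
      (fun s hs a s' hs' => (hT s hs a).2.2.1 s' hs') π j R π₁ π₂ _ _ _ hs₀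
  have hIcc : ∀ π₁ π₂, gameValue G.H G.s₀ P π j R π₁ π₂ ∈ Set.Icc (0 : ℝ) 1 := fun π₁ π₂ => by
    rw [hval]
    exact hP's.gameValue_mem_Icc _ _ _ _
  have hbdd : ∀ π₂, BddAbove (Set.range fun π₁ => gameValue G.H G.s₀ P π j R π₁ π₂) :=
    fun π₂ => ⟨1, by rintro _ ⟨π₁, rfl⟩; exact (hIcc π₁ π₂).2⟩
  -- Exactness of the solver says something only once a minimizer exists.
  have hmin := hsolve P π j (exists_isArgMin G.H G.s₀ P π j R hbdd)
  set π₂ := solve P π j with hπ₂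
  -- Every deviation is available to the max-player: it just ignores the annotations.
  let π₁ : MaxPolicy π (φ j).Q j := fun ζ => π' (forget ζ)
  have hπ₁ : (fun ζ => π₁ (ann π j R ζ)) = π' := by
    funext ζ
    simp only [π₁, ann, forget_annotate]
  have h1 : gameValue G.H G.s₀ P π j R π₁ π₂ ≤ minMaxValue G.H G.s₀ P π j R := by
    have : Nonempty (MinPolicy π (φ j).Q j) := ⟨π₂⟩
    exact (le_ciSup (hbdd π₂) π₁).trans (le_ciInf hmin)
  have h2 := hπ j
  have h3 := hP's.gameValue_eq G.H G.s₀ π₁ π₂ (I := I)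
    (τ := verifyNashPunishment I φ solve P π) rfl
  rw [hπ₁] at h3
  have h4 := G.isStochastic.abs_iterate_evalStep_sub_le hP's hclose
    (Function.update (π.join (verifyNashPunishment I φ solve P π)) j π')
    (satInd_mem_Icc I (φ j)) G.H ⟨[], G.s₀⟩
  rw [← score_eq_iterate, ← h3, ← hval] at h4
  have h5 := (abs_le.1 h4).2
  linarith

end Soundness

open ENNReal

/-! ## Concentration of the empirical frequencies -/

section Concentration

/-- Hoeffding's lemma for an indicator, whose range has length `1`. -/
theorem sum_mul_exp_le {B : Type*} [Fintype B] [DecidableEq B] (μ : PMF B) (x : B) (t : ℝ) :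
    ∑ b, (μ b).toReal * Real.exp (t * ((if b = x then 1 else 0) - (μ x).toReal)) ≤
      Real.exp (t ^ 2 / 8) := by
  let _ : MeasurableSpace B := ⊤
  have hmean : ∫ b, (if b = x then (1 : ℝ) else 0) ∂μ.toMeasure = (μ x).toReal := by
    rw [PMF.integral_eq_sum]
    simp
  have h := (ProbabilityTheory.hasSubgaussianMGF_of_mem_Icc (μ := μ.toMeasure)
    (X := fun b => if b = x then (1 : ℝ) else 0) (a := 0) (b := 1)
    (measurable_from_top.aemeasurable)
    (Filter.Eventually.of_forall fun b => by split_ifs <;> simp)).mgf_le t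
  rw [hmean, ProbabilityTheory.mgf, PMF.integral_eq_sum] at h
  refine h.trans_eq ?_
  congr 1
  norm_num
  ring

open Classical in
/-- The relative frequency of `x` in the sample `X`. -/
noncomputable def freq {B : Type*} {K : ℕ} (X : Fin K → B) (x : B) : ℝ :=
  ((Finset.univ.filter fun k => X k = x).card : ℝ) / (K : ℝ)

theorem freq_nonneg {B : Type*} {K : ℕ} (X : Fin K → B) (x : B) : 0 ≤ freq X x := by
  unfold freq; positivity

theorem freq_eq_zero {B : Type*} {K : ℕ} {X : Fin K → B} {x : B} (h : ∀ k, X k ≠ x) :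
    freq X x = 0 := by
  simp [freq, h]

theorem sum_freq {B : Type*} [Fintype B] {K : ℕ} (hK : 0 < K) (X : Fin K → B) :
    ∑ x, freq X x = 1 := by
  classical
  have h := Finset.card_eq_sum_card_fiberwise (f := X) (s := Finset.univ) (t := Finset.univ)
    fun _ _ => Finset.mem_coe.2 (Finset.mem_univ _)
  rw [Finset.card_univ, Fintype.card_fin] at h
  unfold freq
  rw [← Finset.sum_div, ← Nat.cast_sum, div_eq_one_iff_eq (Nat.cast_ne_zero.2 hK.ne')]
  norm_cast
  convert h.symm

/-- Markov's inequality, as domination of the indicator of `E` by `g`. -/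
theorem toOuterMeasure_le_ofReal_sum {B : Type*} [Fintype B] (μ : PMF B) (E : Set B) {g : B → ℝ}
    (hg : 0 ≤ g) (hE : ∀ b ∈ E, 1 ≤ g b) :
    μ.toOuterMeasure E ≤ ENNReal.ofReal (∑ b, (μ b).toReal * g b) := by
  classical
  rw [PMF.toOuterMeasure_apply, tsum_fintype,
    ENNReal.ofReal_sum_of_nonneg fun b _ => mul_nonneg ENNReal.toReal_nonneg (hg b)]
  refine Finset.sum_le_sum fun b _ => ?_
  rw [ENNReal.ofReal_mul ENNReal.toReal_nonneg, ENNReal.ofReal_toReal (μ.apply_ne_top b)]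
  by_cases h : b ∈ E
  · rw [Set.indicator_of_mem h]
    exact le_mul_of_one_le_right' (ENNReal.one_le_ofReal.2 (hE b h))
  · rw [Set.indicator_of_notMem h]
    exact zero_le

/-- Hoeffding's inequality for the empirical frequencies. -/
theorem toOuterMeasure_freq_le {B : Type*} [Fintype B] (μ : PMF B) {K : ℕ} (hK : 0 < K) (x : B)
    {η : ℝ} (hη : 0 ≤ η) :
    (prodPMF fun _ : Fin K => μ).toOuterMeasure {X | η < |(μ x).toReal - freq X x|} ≤
      ENNReal.ofReal (2 * Real.exp (-2 * K * η ^ 2)) := by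
  classical
  set q := (μ x).toReal
  have hK' : (0 : ℝ) < K := Nat.cast_pos.2 hK
  set Y : (Fin K → B) → ℝ := fun X => ∑ k, ((if X k = x then (1 : ℝ) else 0) - q) with hY
  have hYfreq : ∀ X, Y X = K * (freq X x - q) := fun X => by
    have e : ((Finset.univ.filter fun k => X k = x).card : ℝ) =
        ∑ k, (if X k = x then (1 : ℝ) else 0) := by
      rw [Finset.sum_ite, Finset.sum_const_zero, add_zero, Finset.sum_const, nsmul_eq_mul, mul_one]
    simp only [hY]
    rw [Finset.sum_sub_distrib, Finset.sum_const, Finset.card_univ, Fintype.card_fin, ← e,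
      nsmul_eq_mul, mul_sub]
    congr 1
    unfold freq
    rw [mul_div_cancel₀ _ hK'.ne']
  -- Chernoff bound for both tails at once. The exponent `-t K η + K t ^ 2 / 8` is smallest at `t =
  -- 4 η`, where it equals `-2 K η ^ 2`.
  set g : (Fin K → B) → ℝ := fun X =>
    Real.exp (-4 * K * η ^ 2) * (Real.exp (4 * η * Y X) + Real.exp (-4 * η * Y X)) with hg
  have hg0 : 0 ≤ g := fun X => by simp only [hg, Pi.zero_apply]; positivity
  refine (toOuterMeasure_le_ofReal_sum _ _ hg0 fun X hX => ?_).trans (ENNReal.ofReal_le_ofReal ?_)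
  · have hX' : η < |q - freq X x| := hX
    have hXY : K * η ≤ |Y X| := by
      rw [hYfreq, abs_mul, abs_of_pos hK', abs_sub_comm]
      exact mul_le_mul_of_nonneg_left hX'.le hK'.le
    have key : 4 * η * (K * η) ≤ 4 * η * |Y X| :=
      mul_le_mul_of_nonneg_left hXY (by positivity)
    simp only [hg, mul_add, ← Real.exp_add]
    rcases abs_cases (Y X) with ⟨h, -⟩ | ⟨h, -⟩
    · have h1 : 1 ≤ Real.exp (-4 * K * η ^ 2 + 4 * η * Y X) := by
        rw [Real.one_le_exp_iff]; rw [h] at key; linarith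
      linarith [Real.exp_pos (-4 * K * η ^ 2 + -4 * η * Y X)]
    · have h1 : 1 ≤ Real.exp (-4 * K * η ^ 2 + -4 * η * Y X) := by
        rw [Real.one_le_exp_iff]; rw [h] at key; linarith
      linarith [Real.exp_pos (-4 * K * η ^ 2 + 4 * η * Y X)]
  · have hmgf : ∀ t : ℝ, ∑ X : Fin K → B, ((prodPMF fun _ : Fin K => μ) X).toReal *
        Real.exp (t * Y X) ≤ Real.exp (K * (t ^ 2 / 8)) := fun t => by
      have e : ∀ X : Fin K → B, ((prodPMF fun _ : Fin K => μ) X).toReal * Real.exp (t * Y X) =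
          ∏ k, (μ (X k)).toReal * Real.exp (t * ((if X k = x then 1 else 0) - q)) := fun X => by
        rw [Finset.prod_mul_distrib, ← Real.exp_sum, ← Finset.mul_sum]
        congr 1
        simp only [prodPMF, PMF.ofFintype_apply, ENNReal.toReal_prod]
      simp only [e]
      rw [← Fintype.prod_sum fun (_ : Fin K) b =>
        (μ b).toReal * Real.exp (t * ((if b = x then 1 else 0) - q)), Finset.prod_const,
        Finset.card_univ, Fintype.card_fin, Real.exp_nat_mul]
      exact pow_le_pow_left₀ (Finset.sum_nonneg fun b _ => by positivity) (sum_mul_exp_le μ x t) K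
    have e : ∀ X : Fin K → B, ((prodPMF fun _ : Fin K => μ) X).toReal * g X =
        Real.exp (-4 * K * η ^ 2) *
          (((prodPMF fun _ : Fin K => μ) X).toReal * Real.exp (4 * η * Y X) +
          ((prodPMF fun _ : Fin K => μ) X).toReal * Real.exp (-4 * η * Y X)) := fun X => by
      simp only [hg]; ring
    simp only [e]
    rw [← Finset.mul_sum, Finset.sum_add_distrib]
    calc _ ≤ Real.exp (-4 * K * η ^ 2) * (Real.exp (K * ((4 * η) ^ 2 / 8)) +
          Real.exp (K * ((-4 * η) ^ 2 / 8))) :=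
          mul_le_mul_of_nonneg_left (add_le_add (hmgf _) (hmgf _)) (Real.exp_pos _).le
      _ = 2 * Real.exp (-2 * K * η ^ 2) := by
          rw [mul_add, ← Real.exp_add, ← Real.exp_add, two_mul]
          congr 2 <;> ring

end Concentration

/-! ## Accuracy of the breadth-first estimation -/

section Failure

/-- A union bound for a two-stage experiment: on `E` the second stage is bounded by `1`, off `E` by
`y`. It lets failures be added up although later sampling depends on earlier results. -/
theorem toOuterMeasure_bind_le {α β : Type*} {p : PMF α} {f : α → PMF β} {E : Set α} {E' : Set β}
    {x y : ℝ≥0∞} (hx : p.toOuterMeasure E ≤ x) (hy : ∀ a ∉ E, (f a).toOuterMeasure E' ≤ y) :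
    (p.bind f).toOuterMeasure E' ≤ x + y := by
  classical
  rw [PMF.toOuterMeasure_bind_apply]
  calc ∑' a, p a * (f a).toOuterMeasure E' ≤ ∑' a, (E.indicator p a + p a * y) := by
        refine ENNReal.tsum_le_tsum fun a => ?_
        by_cases h : a ∈ E
        · rw [Set.indicator_of_mem h]
          refine le_add_right (mul_le_of_le_one_right' ?_)
          calc (f a).toOuterMeasure E' ≤ (f a).toOuterMeasure Set.univ :=
                (f a).toOuterMeasure.mono (Set.subset_univ _)
            _ = 1 := by
                rw [PMF.toOuterMeasure_apply, Set.indicator_univ, PMF.tsum_coe]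
        · exact le_add_left (mul_le_mul_right (hy a h) _)
    _ ≤ x + y := by
        rw [ENNReal.tsum_add, ← PMF.toOuterMeasure_apply, ENNReal.tsum_mul_right, PMF.tsum_coe,
          one_mul]
        exact add_le_add_left hx _

theorem one_sub_le_toOuterMeasure {α : Type*} {μ : PMF α} {E : Set α} {x : ℝ} (hx : 0 ≤ x)
    (h : μ.toOuterMeasure Eᶜ ≤ ENNReal.ofReal x) : 1 - x ≤ (μ.toOuterMeasure E).toReal := by
  have huniv : μ.toOuterMeasure Set.univ = 1 := by
    rw [PMF.toOuterMeasure_apply, Set.indicator_univ, PMF.tsum_coe]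
  have hE : μ.toOuterMeasure E ≠ ∞ :=
    ((μ.toOuterMeasure.mono (Set.subset_univ _)).trans_lt (huniv.trans_lt ENNReal.one_lt_top)).ne
  have h1 : 1 ≤ μ.toOuterMeasure E + ENNReal.ofReal x := by
    rw [← huniv, ← Set.union_compl_self E]
    exact (MeasureTheory.measure_union_le E Eᶜ).trans (add_le_add_right h _)
  have h2 := ENNReal.toReal_mono (ENNReal.add_ne_top.2 ⟨hE, ENNReal.ofReal_ne_top⟩) h1
  rw [ENNReal.toReal_add hE ENNReal.ofReal_ne_top, ENNReal.toReal_ofReal hx,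
    ENNReal.toReal_one] at h2
  linarith

end Failure

/-! ### The breadth-first search and its invariant -/

section BFS

variable {n : ℕ} {S : Type*} {A : Fin n → Type*}

/-- `d'` is obtained from `d` by discovering states. -/
structure BFSState.Extends (d d' : BFSState S A) : Prop where
  est : d'.est = d.est
  seen : d.seen ⊆ d'.seen
  queue : ∀ s ∈ d.queue, s ∈ d'.queue
  count : d'.seen.card + d.queue.length = d.seen.card + d'.queue.length
  old : ∀ s ∈ d'.seen, s ∉ d'.queue → s ∈ d.seen
  sub : (∀ s ∈ d.queue, s ∈ d.seen) → ∀ s ∈ d'.queue, s ∈ d'.seen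

theorem BFSState.Extends.refl (d : BFSState S A) : d.Extends d :=
  ⟨rfl, subset_rfl, fun _ h => h, rfl, fun _ h _ => h, fun h => h⟩

theorem BFSState.Extends.trans {d d' d'' : BFSState S A} (h : d.Extends d') (h' : d'.Extends d'') :
    d.Extends d'' where
  est := h'.est.trans h.est
  seen := h.seen.trans h'.seen
  queue s hs := h'.queue s (h.queue s hs)
  count := by have := h.count; have := h'.count; omega
  old s hs hs' := h.old s (h'.old s hs hs') fun hq => hs' (h'.queue s hq)
  sub hd := h'.sub (h.sub hd)

theorem BFSState.extends_discover (d : BFSState S A) (s : S) : d.Extends (d.discover s) := by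
  classical
  unfold BFSState.discover
  split_ifs with hs
  · exact .refl d
  · refine ⟨rfl, Finset.subset_insert _ _, fun x hx => List.mem_append_left _ hx, ?_, ?_, ?_⟩
    · simp only [Finset.card_insert_of_notMem hs, List.length_append, List.length_singleton]
      omega
    · intro x hx hq
      rcases Finset.mem_insert.1 hx with rfl | hx
      · exact absurd (List.mem_append_right _ (List.mem_singleton.2 rfl)) hq
      · exact hx
    · intro hd x hx
      rcases List.mem_append.1 hx with hx | hx
      · exact Finset.mem_insert_of_mem (hd x hx)
      · rw [List.mem_singleton.1 hx]; exact Finset.mem_insert_self _ _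

theorem BFSState.mem_seen_discover (d : BFSState S A) (s : S) : s ∈ (d.discover s).seen := by
  classical
  unfold BFSState.discover
  split_ifs with hs
  · exact hs
  · exact Finset.mem_insert_self _ _

theorem BFSState.extends_foldl_discover (l : List S) (d : BFSState S A) :
    d.Extends (l.foldl BFSState.discover d) := by
  induction l generalizing d with
  | nil => exact .refl d
  | cons s l ih => exact (d.extends_discover s).trans (ih _)

theorem BFSState.mem_seen_foldl_discover {l : List S} {s : S} (hs : s ∈ l) (d : BFSState S A) :
    s ∈ (l.foldl BFSState.discover d).seen := by
  induction l generalizing d with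
  | nil => simp at hs
  | cons x l ih =>
    rcases List.mem_cons.1 hs with rfl | hs
    · exact (extends_foldl_discover l _).seen (d.mem_seen_discover s)
    · exact ih hs _

variable [Fintype S]

/-- The row of an estimate at `(s, a)` is a probability vector supported in `T` with error at most
`η`. -/
def RowAccurate (G : MarkovGame n S A) (η : ℝ) (T : Set S) (P : S → (∀ i, A i) → S → ℝ) (s : S)
    (a : ∀ i, A i) : Prop :=
  (∀ s', 0 ≤ P s a s') ∧ ∑ s', P s a s' = 1 ∧ (∀ s' ∉ T, P s a s' = 0) ∧
    ∀ s', |(G.P s a s').toReal - P s a s'| ≤ η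

/-- The invariant of the breadth-first search, with `r` rounds left, when the pairs in `pend` are
still to be explored. -/
structure BFSInvariant (G : MarkovGame n S A) (η : ℝ) (pend : Set (S × (∀ i, A i))) (r : ℕ)
    (d : BFSState S A) : Prop where
  start : G.s₀ ∈ d.seen
  sub : ∀ s ∈ d.queue, s ∈ d.seen
  count : d.seen.card + r = d.queue.length + Fintype.card S
  row : ∀ s ∈ d.seen, s ∉ d.queue → ∀ a, (s, a) ∉ pend → RowAccurate G η d.seen d.est s a

variable {G : MarkovGame n S A} {η : ℝ} {r : ℕ} {K : ℕ}

theorem BFSInvariant.mono {pend pend' : Set (S × (∀ i, A i))} (h : pend ⊆ pend')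
    {d : BFSState S A} (hd : BFSInvariant G η pend r d) : BFSInvariant G η pend' r d :=
  ⟨hd.start, hd.sub, hd.count, fun s hs hq a ha => hd.row s hs hq a fun h' => ha (h h')⟩

/-- New states enter the queue, so no row is owed for them yet. The sampled states are all
discovered, which gives the support of the new row; old rows keep theirs as the discovered set
grows. -/
theorem BFSInvariant.explore {pend : Set (S × (∀ i, A i))} {d : BFSState S A}
    (hd : BFSInvariant G η pend r d) (hK : 0 < K) (s : S) (a : ∀ i, A i) {X : Fin K → S}
    (hX : ∀ s', |(G.P s a s').toReal - freq X s'| ≤ η) :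
    BFSInvariant G η (pend \ {(s, a)}) r
      (((List.ofFn X).foldl BFSState.discover d).store s a X) := by
  classical
  have hext := BFSState.extends_foldl_discover (List.ofFn X) d
  have hmem : ∀ k, X k ∈ ((List.ofFn X).foldl BFSState.discover d).seen := fun k =>
    BFSState.mem_seen_foldl_discover (List.mem_ofFn.2 ⟨k, rfl⟩) d
  set d' := (List.ofFn X).foldl BFSState.discover d
  refine ⟨hext.seen hd.start, hext.sub hd.sub, ?_, ?_⟩
  · have h1 := hext.count
    have h2 := hd.count
    change d'.seen.card + r = d'.queue.length + Fintype.card S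
    omega
  · intro s₁ hs₁ hq₁ a₁ ha₁
    by_cases h : s₁ = s ∧ a₁ = a
    · obtain ⟨rfl, rfl⟩ := h
      have e : ∀ s', (d'.store s₁ a₁ X).est s₁ a₁ s' = freq X s' := fun s' => by
        simp [BFSState.store, freq]
      unfold RowAccurate
      simp only [e]
      refine ⟨freq_nonneg X, sum_freq hK X, fun s' hs' => freq_eq_zero fun k hk => hs' ?_, hX⟩
      rw [← hk]
      exact hmem k
    · have e : ∀ s', (d'.store s a X).est s₁ a₁ s' = d.est s₁ a₁ s' := fun s' => by
        simp only [BFSState.store, if_neg h, hext.est]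
      have hrow := hd.row s₁ (hext.old s₁ hs₁ hq₁) (fun hq => hq₁ (hext.queue s₁ hq)) a₁
        fun hp => ha₁ ⟨hp, fun heq => h (Prod.mk.inj heq)⟩
      unfold RowAccurate at hrow ⊢
      simp only [e]
      exact ⟨hrow.1, hrow.2.1, fun s' hs' => hrow.2.2.1 s' fun hs => hs' (hext.seen hs),
        hrow.2.2.2⟩

/-- Leaving the queue makes the rows of `s` due, so all its actions become pending; the lost queue
entry pays for the round. -/
theorem BFSInvariant.pop {d : BFSState S A} (hd : BFSInvariant G η ∅ (r + 1) d) {s : S}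
    {l : List S} (hq : d.queue = s :: l) :
    BFSInvariant G η {x | x.1 = s} r { d with queue := l } := by
  refine ⟨hd.start, fun x hx => hd.sub x (by rw [hq]; exact List.mem_cons_of_mem _ hx), ?_, ?_⟩
  · have := hd.count
    rw [hq, List.length_cons] at this
    change d.seen.card + r = l.length + Fintype.card S
    omega
  · intro x hx hxl a hxa
    refine hd.row x hx ?_ a (Set.notMem_empty _)
    rw [hq, List.mem_cons]
    rintro (h | h)
    · exact hxa h
    · exact hxl h

/-- The probability bound for the failure of the estimation at one state-action pair. -/
noncomputable def failBound (S : Type*) [Fintype S] (K : ℕ) (η : ℝ) : ℝ :=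
  Fintype.card S * (2 * Real.exp (-2 * K * η ^ 2))

theorem exploreAction_fail_le (hK : 0 < K) (hη : 0 ≤ η) {pend : Set (S × (∀ i, A i))}
    {d : BFSState S A} (hd : BFSInvariant G η pend r d) (s : S) (a : ∀ i, A i) :
    (exploreAction G K s a d).toOuterMeasure {d' | ¬ BFSInvariant G η (pend \ {(s, a)}) r d'} ≤
      ENNReal.ofReal (failBound S K η) := by
  rw [exploreAction, PMF.toOuterMeasure_map_apply]
  calc _ ≤ (prodPMF fun _ : Fin K => G.P s a).toOuterMeasure
        (⋃ s', {X | η < |(G.P s a s').toReal - freq X s'|}) := by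
        refine MeasureTheory.measure_mono fun X hX => ?_
        by_contra hcon
        simp only [Set.mem_iUnion, Set.mem_ofPred_eq, not_exists, not_lt] at hcon
        exact hX (hd.explore hK s a hcon)
    _ ≤ ∑ s', (prodPMF fun _ : Fin K => G.P s a).toOuterMeasure
        {X | η < |(G.P s a s').toReal - freq X s'|} := MeasureTheory.measure_iUnion_fintype_le _ _
    _ ≤ ∑ _s' : S, ENNReal.ofReal (2 * Real.exp (-2 * K * η ^ 2)) :=
        Finset.sum_le_sum fun s' _ => toOuterMeasure_freq_le _ hK s' hη
    _ = ENNReal.ofReal (failBound S K η) := by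
        rw [Finset.sum_const, Finset.card_univ, nsmul_eq_mul, failBound,
          ENNReal.ofReal_mul (Nat.cast_nonneg _), ENNReal.ofReal_natCast]

theorem exploreActions_fail_le (hK : 0 < K) (hη : 0 ≤ η) (s : S) (l : List (∀ i, A i))
    {d : BFSState S A} (hd : BFSInvariant G η {x | x.1 = s ∧ x.2 ∈ l} r d) :
    (exploreActions G K s l d).toOuterMeasure {d' | ¬ BFSInvariant G η ∅ r d'} ≤
      l.length * ENNReal.ofReal (failBound S K η) := by
  induction l generalizing d with
  | nil =>
    have : BFSInvariant G η ∅ r d := hd.mono (by simp)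
    simp [exploreActions, PMF.toOuterMeasure_pure_apply, this]
  | cons a l ih =>
    rw [exploreActions, List.length_cons, Nat.cast_succ, add_mul, one_mul, add_comm]
    refine toOuterMeasure_bind_le (exploreAction_fail_le hK hη hd s a) fun d' hd' => ih ?_
    refine (not_not.1 hd' : BFSInvariant G η _ r d').mono ?_
    rintro ⟨x, b⟩ ⟨⟨hx, hb⟩, hne⟩
    refine ⟨hx, (List.mem_cons.1 hb).resolve_left fun h => hne ?_⟩
    exact Set.mem_singleton_iff.2 (Prod.ext hx h)

variable [∀ i, Fintype (A i)]

theorem BFSInvariant.isAccurate {d : BFSState S A} (hd : BFSInvariant G η ∅ r d)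
    (hq : d.queue = []) : IsAccurate G η d.est :=
  ⟨d.seen, hd.start, fun s hs a => hd.row s hs (by simp [hq]) a (Set.notMem_empty _)⟩

theorem bfsLoop_fail_le (hK : 0 < K) (hη : 0 ≤ η) {d : BFSState S A}
    (hd : BFSInvariant G η ∅ r d) :
    (bfsLoop G K r d).toOuterMeasure {d' | ¬ IsAccurate G η d'.est} ≤
      r * (Fintype.card (∀ i, A i) * ENNReal.ofReal (failBound S K η)) := by
  induction r generalizing d with
  | zero =>
    -- With no rounds left the count reads `seen = queue + |S|`, and at most `|S|` states can be
    -- seen.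
    have hq : d.queue = [] := by
      have h1 := hd.count
      have h2 := Finset.card_le_univ d.seen
      exact List.length_eq_zero_iff.1 (by omega)
    simp [bfsLoop, PMF.toOuterMeasure_pure_apply, hd.isAccurate hq]
  | succ r ih =>
    rw [bfsLoop]
    split
    · next hq => simp [PMF.toOuterMeasure_pure_apply, hd.isAccurate hq]
    · next s l hq =>
      rw [Nat.cast_succ, add_mul, one_mul, add_comm]
      refine toOuterMeasure_bind_le (E := {d' | ¬ BFSInvariant G η ∅ r d'}) ?_
        fun d' hd' => ih (not_not.1 hd')
      have hsub : {x : S × (∀ i, A i) | x.1 = s} ⊆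
          {x | x.1 = s ∧ x.2 ∈ (Finset.univ : Finset (∀ i, A i)).toList} :=
        fun x hx => ⟨hx, by simp⟩
      have := exploreActions_fail_le hK hη s _ ((hd.pop hq).mono hsub)
      rwa [Finset.length_toList, Finset.card_univ] at this

theorem bfsEstimate_fail_le (hK : 0 < K) (hη : 0 ≤ η) :
    (bfsEstimate G K).toOuterMeasure {P | ¬ IsAccurate G η P} ≤
      ENNReal.ofReal (Fintype.card S * (Fintype.card (∀ i, A i) * failBound S K η)) := by
  rw [bfsEstimate, PMF.toOuterMeasure_map_apply, ENNReal.ofReal_mul (Nat.cast_nonneg _),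
    ENNReal.ofReal_mul (Nat.cast_nonneg _), ENNReal.ofReal_natCast, ENNReal.ofReal_natCast]
  have hinit : BFSInvariant G η ∅ (Fintype.card S)
      (⟨{G.s₀}, [G.s₀], fun _ _ _ => 0⟩ : BFSState S A) :=
    ⟨by simp, by simp, by simp, fun s hs hq => by simp_all⟩
  exact bfsLoop_fail_le hK hη hinit

end BFS

/-! ## Soundness of the search -/

section Search

variable {n : ℕ} {S AP : Type*} {A : Fin n → Type*} [Fintype S] [∀ i, Fintype (A i)]

theorem searchList_eq_some {G : MarkovGame n S A} {I : AP → S → Bool} {φ : Fin n → Spec AP}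
    {solve : Solver S A φ} {ε δ : ℝ} {P : S → (∀ i, A i) → S → ℝ} {l : List (FSPolicy S A)}
    {ρ : Profile S A} (h : searchList G I φ solve ε δ P l = some ρ) :
    ∃ π ∈ l, verifyNash G I φ ε δ P π ∧ ρ = π.join (verifyNashPunishment I φ solve P π) := by
  induction l with
  | nil => simp [searchList] at h
  | cons π l ih =>
    rw [searchList] at h
    split_ifs at h with hπ
    · exact ⟨π, by simp, hπ, (Option.some.inj h).symm⟩
    · obtain ⟨π', hl, hπ'⟩ := ih h
      exact ⟨π', List.mem_cons_of_mem _ hl, hπ'⟩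

theorem isEpsNash_of_horizon_eq_zero {G : MarkovGame n S A} (hH : G.H = 0) (I : AP → S → Bool)
    (φ : Fin n → Spec AP) {ε : ℝ} (hε : 0 ≤ ε) (μ : Profile S A) : IsEpsNash G I φ ε μ := by
  intro i π'
  simp only [score, hH, trajLaw]
  linarith

theorem le_foldr_max {l : List ℕ} {m : ℕ} (h : m ∈ l) : m ≤ l.foldr max 0 := by
  induction l with
  | nil => simp at h
  | cons x l ih =>
    rcases List.mem_cons.1 h with rfl | h
    · exact le_max_left _ _
    · exact (ih h).trans (le_max_right _ _)

/-- The number of samples suffices for the accuracy needed in the verification. -/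
theorem sampleSize_spec [Nonempty S] [Nonempty (∀ i, A i)] {H M Q : ℕ} (hH : 0 < H) (hM : 0 < M)
    (hQ : 0 < Q) {δ p : ℝ} (hδ : 0 < δ) (hp : p ∈ Set.Ioc (0 : ℝ) 1) :
    ∃ η : ℝ, 0 ≤ η ∧ (H : ℝ) * (Fintype.card S * η) ≤ δ ∧ 0 < sampleSize S A H M Q δ p ∧
      Fintype.card S * (Fintype.card (∀ i, A i) * failBound S (sampleSize S A H M Q δ p) η) ≤
        p := by
  obtain ⟨hp0, hp1⟩ := hp
  set K := sampleSize S A H M Q δ p with hKdef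
  have hS : (1 : ℝ) ≤ Fintype.card S := Nat.one_le_cast.2 Fintype.card_pos
  have hA : (1 : ℝ) ≤ Fintype.card (∀ i, A i) := Nat.one_le_cast.2 Fintype.card_pos
  have hH' : (1 : ℝ) ≤ H := Nat.one_le_cast.2 hH
  have hM' : (1 : ℝ) ≤ M := Nat.one_le_cast.2 hM
  have hQ' : (1 : ℝ) ≤ Q := Nat.one_le_cast.2 hQ
  rw [sampleSize] at hKdef
  set s : ℝ := (Fintype.card S : ℝ)
  set c : ℝ := (Fintype.card (∀ i, A i) : ℝ)
  have hs0 : 0 < s := by linarith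
  have hc0 : 0 < c := by linarith
  have hH0 : (0 : ℝ) < H := by linarith
  have hM0 : (0 : ℝ) < M := by linarith
  have hQ0 : (0 : ℝ) < Q := by linarith
  have harg : 1 < 2 * s ^ 2 * c / p := by
    rw [lt_div_iff₀ hp0]
    nlinarith [one_le_mul_of_one_le_of_one_le (one_le_pow₀ hS (n := 2)) hA]
  have hlog := Real.log_pos harg
  have hKle := Nat.le_ceil (2 * s ^ 2 * (M : ℝ) ^ 2 * (Q : ℝ) ^ 2 * (H : ℝ) ^ 4 / δ ^ 2 *
    Real.log (2 * s ^ 2 * c / p))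
  rw [← hKdef] at hKle
  -- This `η` turns the lower bound on `K` into `2 K η ^ 2 ≥ log (2 |S| ^ 2 |A| / p)`, which is what
  -- the union bound needs. For the accuracy, `1 / (|S| H)` in place of the last factors would do;
  -- the surplus is absorbed by `M, Q, H ≥ 1`.
  refine ⟨δ / (2 * s * M * Q * H ^ 2), by positivity, ?_, ?_, ?_⟩
  · have e : (H : ℝ) * (s * (δ / (2 * s * M * Q * H ^ 2))) = δ / (2 * (M * Q * H)) := by
      field_simp
    rw [e]
    refine div_le_self hδ.le ?_
    have := one_le_mul_of_one_le_of_one_le (one_le_mul_of_one_le_of_one_le hM' hQ') hH'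
    linarith
  · rw [hKdef]
    exact Nat.ceil_pos.2 (by positivity)
  · have hexp : Real.exp (-2 * K * (δ / (2 * s * M * Q * H ^ 2)) ^ 2) ≤ p / (2 * s ^ 2 * c) := by
      have h1 : Real.log (2 * s ^ 2 * c / p) ≤ 2 * K * (δ / (2 * s * M * Q * H ^ 2)) ^ 2 := by
        have h2 := mul_le_mul_of_nonneg_left hKle
          (by positivity : 0 ≤ 2 * (δ / (2 * s * M * Q * H ^ 2)) ^ 2)
        refine Eq.trans_le ?_ (h2.trans_eq (by ring))
        field_simp
      calc _ ≤ Real.exp (-Real.log (2 * s ^ 2 * c / p)) := Real.exp_le_exp.2 (by linarith)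
        _ = _ := by rw [Real.exp_neg, Real.exp_log (by linarith), inv_div]
    calc s * (c * failBound S K (δ / (2 * s * M * Q * H ^ 2)))
        = 2 * s ^ 2 * c * Real.exp (-2 * K * (δ / (2 * s * M * Q * H ^ 2)) ^ 2) := by
          rw [failBound]; ring
      _ ≤ 2 * s ^ 2 * c * (p / (2 * s ^ 2 * c)) := mul_le_mul_of_nonneg_left hexp (by positivity)
      _ = p := by field_simp

/-- For every list of candidates, the estimation leads to a wrong answer with probability at most
`p`. -/
theorem bfsEstimate_search_fail_le (G : MarkovGame n S A) (I : AP → S → Bool)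
    (φ : Fin n → Spec AP) {solve : Solver S A φ} (hsolve : solve.IsExact G I) {p ε δ : ℝ}
    (hp : p ∈ Set.Ioc (0 : ℝ) 1) (hε : 0 < ε) (hδ : 0 < δ) (l : List (FSPolicy S A)) :
    (bfsEstimate G (sampleSize S A G.H ((l.map FSPolicy.mem).foldr max 0)
      (Finset.univ.sup fun j => Fintype.card (φ j).Q) δ p)).toOuterMeasure
        {P | ¬ ∀ ρ, searchList G I φ solve ε δ P l = some ρ → IsEpsNash G I φ ε ρ} ≤
      ENNReal.ofReal p := by
  -- In degenerate cases (`H = 0`, no candidates, no agents) the sample size is `0` and the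
  -- frequencies mean nothing, but then no wrong answer is possible. Conversely, one wrong answer
  -- for some `P₀` supplies all the positivity that `sampleSize_spec` requires.
  by_cases htriv : ∀ P ρ, searchList G I φ solve ε δ P l = some ρ → IsEpsNash G I φ ε ρ
  · have : {P | ¬ ∀ ρ, searchList G I φ solve ε δ P l = some ρ → IsEpsNash G I φ ε ρ} = ∅ :=
      Set.eq_empty_of_forall_notMem fun P hP => hP (htriv P)
    rw [this, MeasureTheory.measure_empty]
    exact zero_le
  · push Not at htriv
    obtain ⟨P₀, ρ₀, h₀, hρ₀⟩ := htriv
    obtain ⟨π₀, hπ₀, -⟩ := searchList_eq_some h₀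
    have : Nonempty S := ⟨G.s₀⟩
    have : Nonempty (∀ i, A i) := ⟨π₀.σ G.s₀ π₀.m₀⟩
    have hH : 0 < G.H := Nat.pos_of_ne_zero fun hH =>
      hρ₀ (isEpsNash_of_horizon_eq_zero hH I φ hε.le ρ₀)
    have hM : 0 < (l.map FSPolicy.mem).foldr max 0 :=
      π₀.m₀.pos.trans_le (le_foldr_max (List.mem_map_of_mem hπ₀))
    have hQ : 0 < Finset.univ.sup fun j => Fintype.card (φ j).Q := by
      obtain ⟨j, -⟩ := not_forall.1 hρ₀
      exact (Fintype.card_pos_iff.2 ⟨((φ j).dfa I).start⟩).trans_le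
        (Finset.le_sup (f := fun j => Fintype.card (φ j).Q) (Finset.mem_univ j))
    obtain ⟨η, hη, hηδ, hK, hfail⟩ := sampleSize_spec (S := S) (A := A) hH hM hQ hδ hp
    refine le_trans (MeasureTheory.measure_mono (t := {P | ¬ IsAccurate G η P})
      fun P hP hacc => hP fun ρ hρ => ?_)
      ((bfsEstimate_fail_le hK hη).trans (ENNReal.ofReal_le_ofReal hfail))
    obtain ⟨π, -, hπ, rfl⟩ := searchList_eq_some hρ
    exact IsAccurate.isEpsNash_join hη hacc hsolve hηδ hπ

end Search

end SpecNash

open SpecNash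
theorem mainTheorem2 {n : ℕ} {S AP : Type*} {A : Fin n → Type*} [Fintype S] [∀ i, Fintype (A i)]
    (G : MarkovGame n S A) (I : AP → S → Bool) (φ : Fin n → Spec AP)
    (enumerate : PMF (List (FSPolicy S A)))
    (solve : Solver S A φ) (hsolve : solve.IsExact G I)
    (p ε δ : ℝ) (hp : p ∈ Set.Ioc (0 : ℝ) 1) (hε : 0 < ε) (hδ : δ ∈ Set.Ioo (0 : ℝ) ε) :
    1 - p ≤ ((highNashSearch G I φ enumerate solve ε δ p).toOuterMeasure
      {o | ∀ π : Profile S A, o = some π → IsEpsNash G I φ ε π}).toReal := by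
  refine one_sub_le_toOuterMeasure hp.1.le ?_
  rw [← zero_add (ENNReal.ofReal p)]
  -- Drawing the list cannot fail; the bound `p` holds for each list separately since the samples
  -- are fresh.
  refine toOuterMeasure_bind_le (E := ∅) (MeasureTheory.measure_empty ..).le fun l _ => ?_
  rw [PMF.toOuterMeasure_map_apply]
  exact bfsEstimate_search_fail_le G I φ hsolve hp hε hδ.1 l
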